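/- Let $\Bbbk$ be an uncountable algebraically closed field of characteristic $0$, let $n \ge 0$, let $A = \Bbbk[x_1,\dots,x_n]$, and let $\mathcal{V} = \mathrm{Der}_{\Bbbk}(A)$ be the Lie algebra of polynomial vector fields on the affine space $\mathbb{A}^n$. Let $A \# U(\mathcal{V})$ be the smash product, that is, the vector space $A \otimes U(\mathcal{V})$ with the product $(f \otimes u)(g \otimes v) = \sum f\, u^{(1)}(g) \otimes u^{(2)} v$, where $\Delta(u) = \sum u^{(1)} \otimes u^{(2)}$ is the coproduct of $U(\mathcal{V})$. An $A\mathcal{V}$-module is a left module over $A \# U(\mathcal{V})$. For a finitely generated $A\mathcal{V}$-module $M$, let $C \ni 1$ be a finite-dimensional subspace generating the algebra $A \# U(\mathcal{V})$ and let $M_0 \subset M$ be a finite-dimensional subspace generating $M$ as a module. The Gelfand-Kirillov dimension of $M$ is $\mathrm{GKdim}_{A\mathcal{V}}(M) = \limsup_{m \to \infty} \log_m \dim_{\Bbbk}(C^m M_0)$, which does not depend on the choice of $C$ and $M_0$. A finitely generated $A\mathcal{V}$-module $M$ is called holonomic if $M = 0$ or $\mathrm{GKdim}_{A\mathcal{V}}(M)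 = n$. **Theorem.** Every holonomic $A\mathcal{V}$-module has finite length. -/

import Mathlib

open scoped TensorProduct

noncomputable section

section SmashProduct

attribute [local instance 100] LieRing.ofAssociativeRing

/-- The comultiplication `Δ` of the Hopf algebra `U(L)`: the algebra homomorphism
`U(L) → U(L) ⊗ U(L)` with `Δ(η) = η ⊗ 1 + 1 ⊗ η` for `η ∈ L`. -/
def envelopingComul (k L : Type*) [CommRing k] [LieRing L] [LieAlgebra k L] :
    UniversalEnvelopingAlgebra k L →ₐ[k]
      UniversalEnvelopingAlgebra k L ⊗[k] UniversalEnvelopingAlgebra k L :=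
  UniversalEnvelopingAlgebra.lift k
    { toFun := fun η => UniversalEnvelopingAlgebra.ι k η ⊗ₜ[k] 1
        + 1 ⊗ₜ[k] UniversalEnvelopingAlgebra.ι k η
      map_add' := fun η μ => by
        simp only [map_add, TensorProduct.add_tmul, TensorProduct.tmul_add]; abel
      map_smul' := fun c η => by
        simp only [map_smul, TensorProduct.smul_tmul', TensorProduct.tmul_smul, smul_add,
          RingHom.id_apply]
      map_lie' := fun {η μ} => by
        simp only [LieHom.map_lie, LieRing.of_associative_ring_bracket, mul_add, add_mul,
          Algebra.TensorProduct.tmul_mul_tmul, one_mul, mul_one, TensorProduct.sub_tmul,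
          TensorProduct.tmul_sub]
        abel }

/-- The action of `U(Der A)` on `A` that extends the action of derivations on `A`. -/
def derivationAction (k A : Type*) [CommRing k] [CommRing A] [Algebra k A] :
    UniversalEnvelopingAlgebra k (Derivation k A A) →ₐ[k] Module.End k A :=
  UniversalEnvelopingAlgebra.lift k (LieModule.toEnd k (Derivation k A A) A)

/-- The smash product `A # U(Der A)`; its underlying vector space is `A ⊗ U(Der A)`. -/
def DerSmashProduct (k A : Type*) [CommRing k] [CommRing A] [Algebra k A] : Type _ :=
  A ⊗[k] UniversalEnvelopingAlgebra k (Derivation k A A)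

namespace DerSmashProduct

variable (k A : Type*) [CommRing k] [CommRing A] [Algebra k A]

instance : AddCommGroup (DerSmashProduct k A) :=
  inferInstanceAs (AddCommGroup (A ⊗[k] UniversalEnvelopingAlgebra k (Derivation k A A)))

instance : Module k (DerSmashProduct k A) :=
  inferInstanceAs (Module k (A ⊗[k] UniversalEnvelopingAlgebra k (Derivation k A A)))

/-- `u ↦ (g ⊗ v ↦ ∑ u⁽¹⁾(g) ⊗ u⁽²⁾ v)`, where `Δ(u) = ∑ u⁽¹⁾ ⊗ u⁽²⁾`. -/
def comulAction : UniversalEnvelopingAlgebra k (Derivation k A A) →ₐ[k]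
    Module.End k (A ⊗[k] UniversalEnvelopingAlgebra k (Derivation k A A)) :=
  (Module.endTensorEndAlgHom (R := k) (S := k) (A := k) (M := A)
      (N := UniversalEnvelopingAlgebra k (Derivation k A A))).comp
    ((Algebra.TensorProduct.map (derivationAction k A)
        (Algebra.lmul k (UniversalEnvelopingAlgebra k (Derivation k A A)))).comp
      (envelopingComul k (Derivation k A A)))

/-- Multiplication by `f ∈ A` on the first factor: `g ⊗ v ↦ f g ⊗ v`. -/
def leftMul : A →ₐ[k] Module.End k (A ⊗[k] UniversalEnvelopingAlgebra k (Derivation k A A)) :=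
  (Module.endTensorEndAlgHom (R := k) (S := k) (A := k) (M := A)
      (N := UniversalEnvelopingAlgebra k (Derivation k A A))).comp
    (Algebra.TensorProduct.includeLeft.comp (Algebra.lmul k A))

/-- The product of the smash product as a linear map:
`(f ⊗ u) (g ⊗ v) = ∑ f u⁽¹⁾(g) ⊗ u⁽²⁾ v`, where `Δ(u) = ∑ u⁽¹⁾ ⊗ u⁽²⁾`. -/
def mulHom : A ⊗[k] UniversalEnvelopingAlgebra k (Derivation k A A) →ₗ[k]
    Module.End k (A ⊗[k] UniversalEnvelopingAlgebra k (Derivation k A A)) :=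
  TensorProduct.lift
    (((LinearMap.mul k (Module.End k
      (A ⊗[k] UniversalEnvelopingAlgebra k (Derivation k A A)))).comp
        (leftMul k A).toLinearMap).compl₂ (comulAction k A).toLinearMap)

variable {k A}

theorem leftMul_tmul (f g : A) (v : UniversalEnvelopingAlgebra k (Derivation k A A)) :
    leftMul k A f (g ⊗ₜ v) = (f * g) ⊗ₜ v := by
  simp [leftMul, Module.endTensorEndAlgHom_apply]

theorem mulHom_tmul (f : A) (u : UniversalEnvelopingAlgebra k (Derivation k A A)) :
    mulHom k A (f ⊗ₜ u) = leftMul k A f * comulAction k A u := by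
  simp [mulHom]

theorem comulAction_ι (η : Derivation k A A) (g : A)
    (v : UniversalEnvelopingAlgebra k (Derivation k A A)) :
    comulAction k A (UniversalEnvelopingAlgebra.ι k η) (g ⊗ₜ v)
      = η g ⊗ₜ v + g ⊗ₜ (UniversalEnvelopingAlgebra.ι k η * v) := by
  simp only [comulAction, AlgHom.comp_apply, envelopingComul, UniversalEnvelopingAlgebra.lift_ι_apply]
  simp [Module.endTensorEndAlgHom_apply, derivationAction,
    UniversalEnvelopingAlgebra.lift_ι_apply, -UniversalEnvelopingAlgebra.ι_apply]

theorem comulAction_ι_mul_leftMul (η : Derivation k A A) (g : A) :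
    comulAction k A (UniversalEnvelopingAlgebra.ι k η) * leftMul k A g
      = leftMul k A (η g)
        + leftMul k A g * comulAction k A (UniversalEnvelopingAlgebra.ι k η) := by
  apply TensorProduct.ext'
  intro h v
  simp only [Module.End.mul_apply, LinearMap.add_apply, leftMul_tmul, comulAction_ι, map_add,
    Derivation.leibniz, smul_eq_mul, TensorProduct.add_tmul]
  rw [mul_comm h]
  abel

theorem mulHom_leftMul (f : A) (y : A ⊗[k] UniversalEnvelopingAlgebra k (Derivation k A A)) :
    mulHom k A (leftMul k A f y) = leftMul k A f * mulHom k A y := by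
  induction y with
  | zero => simp
  | add x y hx hy => simp only [map_add, hx, hy, mul_add]
  | tmul g v => rw [leftMul_tmul, mulHom_tmul, mulHom_tmul, map_mul, mul_assoc]

theorem mulHom_comulAction (u : UniversalEnvelopingAlgebra k (Derivation k A A)) :
    ∀ y : A ⊗[k] UniversalEnvelopingAlgebra k (Derivation k A A),
      mulHom k A (comulAction k A u y) = comulAction k A u * mulHom k A y := by
  obtain ⟨t, rfl⟩ : ∃ t, UniversalEnvelopingAlgebra.mkAlgHom k (Derivation k A A) t = u :=
    RingCon.mkₐ_surjective _ u
  induction t using TensorAlgebra.induction with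
  | algebraMap r => intro y; simp [Algebra.algebraMap_eq_smul_one]
  | ι η =>
    intro y
    change mulHom k A (comulAction k A (UniversalEnvelopingAlgebra.ι k η) y)
      = comulAction k A (UniversalEnvelopingAlgebra.ι k η) * mulHom k A y
    induction y with
    | zero => simp
    | add x y hx hy => simp only [map_add, hx, hy, mul_add]
    | tmul g v =>
      rw [comulAction_ι, map_add, mulHom_tmul, mulHom_tmul, mulHom_tmul, ← mul_assoc,
        comulAction_ι_mul_leftMul, map_mul, add_mul, mul_assoc]
  | mul a b ha hb =>
    intro y
    rw [map_mul, map_mul, Module.End.mul_apply, ha, hb, mul_assoc]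
  | add a b ha hb =>
    intro y
    simp only [map_add, LinearMap.add_apply, ha, hb, add_mul]

theorem mulHom_mulHom (x y : A ⊗[k] UniversalEnvelopingAlgebra k (Derivation k A A)) :
    mulHom k A (mulHom k A x y) = mulHom k A x * mulHom k A y := by
  induction x with
  | zero => simp
  | add a b ha hb => simp only [map_add, LinearMap.add_apply, ha, hb, add_mul]
  | tmul f u =>
    rw [mulHom_tmul, Module.End.mul_apply, mulHom_leftMul, mulHom_comulAction, mul_assoc]

theorem comulAction_tmul_one (u : UniversalEnvelopingAlgebra k (Derivation k A A)) :
    comulAction k A u (1 ⊗ₜ 1) = 1 ⊗ₜ u := by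
  suffices h : ∀ v, comulAction k A u (1 ⊗ₜ v) = 1 ⊗ₜ (u * v) by simpa using h 1
  obtain ⟨t, rfl⟩ : ∃ t, UniversalEnvelopingAlgebra.mkAlgHom k (Derivation k A A) t = u :=
    RingCon.mkₐ_surjective _ u
  induction t using TensorAlgebra.induction with
  | algebraMap r => intro v; simp [Algebra.algebraMap_eq_smul_one]
  | ι η =>
    intro v
    change comulAction k A (UniversalEnvelopingAlgebra.ι k η) (1 ⊗ₜ v)
      = 1 ⊗ₜ (UniversalEnvelopingAlgebra.ι k η * v)
    rw [comulAction_ι]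
    simp
  | mul a b ha hb =>
    intro v
    rw [map_mul, map_mul, Module.End.mul_apply, hb, ha, mul_assoc]
  | add a b ha hb =>
    intro v
    simp only [map_add, LinearMap.add_apply, ha, hb, add_mul, TensorProduct.tmul_add]

theorem mulHom_one_left (x : A ⊗[k] UniversalEnvelopingAlgebra k (Derivation k A A)) :
    mulHom k A (1 ⊗ₜ 1) x = x := by
  rw [mulHom_tmul, map_one, map_one, one_mul, Module.End.one_apply]

theorem mulHom_one_right (x : A ⊗[k] UniversalEnvelopingAlgebra k (Derivation k A A)) :
    mulHom k A x (1 ⊗ₜ 1) = x := by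
  induction x with
  | zero => simp
  | add a b ha hb => rw [map_add, LinearMap.add_apply, ha, hb]
  | tmul f u =>
    rw [mulHom_tmul, Module.End.mul_apply, comulAction_tmul_one, leftMul_tmul, mul_one]

variable (k A)

instance : Ring (DerSmashProduct k A) :=
  { (inferInstance : AddCommGroup (DerSmashProduct k A)) with
    mul := fun x y => mulHom k A x y
    one := (1 : A) ⊗ₜ[k] (1 : UniversalEnvelopingAlgebra k (Derivation k A A))
    left_distrib := fun x y z => (mulHom k A x).map_add y z
    right_distrib := fun x y z => LinearMap.congr_fun ((mulHom k A).map_add x y) z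
    zero_mul := fun x => LinearMap.congr_fun (mulHom k A).map_zero x
    mul_zero := fun x => (mulHom k A x).map_zero
    mul_assoc := fun x y z => LinearMap.congr_fun (mulHom_mulHom (k := k) (A := A) x y) z
    one_mul := fun x => mulHom_one_left (k := k) (A := A) x
    mul_one := fun x => mulHom_one_right (k := k) (A := A) x }

instance : Algebra k (DerSmashProduct k A) :=
  Algebra.ofModule
    (fun c x y => LinearMap.congr_fun ((mulHom k A).map_smul c x) y)
    (fun c x y => (mulHom k A x).map_smul c y)

variable {A}

/-- The element `f # u` of the smash product. -/
def tmul (f : A) (u : UniversalEnvelopingAlgebra k (Derivation k A A)) : DerSmashProduct k A :=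
  f ⊗ₜ[k] u

variable {k}

/-- `(f # η) (g # μ) = f η(g) # μ + f g # η μ` for derivations `η`, `μ` (in fact, for any `μ`). -/
theorem tmul_mul_tmul (f g : A) (η : Derivation k A A)
    (μ : UniversalEnvelopingAlgebra k (Derivation k A A)) :
    tmul k f (UniversalEnvelopingAlgebra.ι k η) * tmul k g μ
      = tmul k (f * η g) μ + tmul k (f * g) (UniversalEnvelopingAlgebra.ι k η * μ) := by
  change mulHom k A (f ⊗ₜ[k] UniversalEnvelopingAlgebra.ι k η) (g ⊗ₜ[k] μ)
    = (f * η g) ⊗ₜ[k] μ + (f * g) ⊗ₜ[k] (UniversalEnvelopingAlgebra.ι k η * μ)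
  rw [mulHom_tmul, Module.End.mul_apply, comulAction_ι, map_add, leftMul_tmul, leftMul_tmul]

end DerSmashProduct

end SmashProduct

section GelfandKirillov

variable (k R M : Type*) [Field k] [Ring R] [Algebra k R] [AddCommGroup M] [Module k M]
  [Module R M] [IsScalarTower k R M]

/-- `limsup_{m → ∞} log_m (dim (C ^ m M₀))`, where `C ^ m` is spanned by the products of `m`
elements of `C`. -/
def growthExponent {k R M : Type*} [Field k] [Ring R] [Algebra k R] [AddCommGroup M] [Module k M]
    [Module R M] [IsScalarTower k R M] (C : Submodule k R) (M₀ : Submodule k M) : EReal :=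
  Filter.limsup
    (fun m : ℕ => ((Real.logb (m : ℝ) (Module.finrank k ↥(C ^ m • M₀) : ℝ) : ℝ) : EReal))
    Filter.atTop

/-- The Gelfand-Kirillov dimension of the nonzero finitely generated `R`-module `M` is `d`: it is
computed from a finite-dimensional subspace `C ∋ 1` that generates the algebra `R` and a
finite-dimensional subspace `M₀` that generates the `R`-module `M`. (The value does not depend on
the choice of `C` and `M₀`.) -/
def HasGKDim (d : EReal) : Prop :=
  ∃ (C : Submodule k R) (M₀ : Submodule k M),
    C.FG ∧ 1 ∈ C ∧ Algebra.adjoin k (C : Set R) = ⊤ ∧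
    M₀.FG ∧ Submodule.span R (M₀ : Set M) = ⊤ ∧
    growthExponent C M₀ = d

end GelfandKirillov

section Holonomic

/-- The algebra `A # U(𝒱)` of the affine space `𝔸ⁿ`, with `A = k[x₁, …, xₙ]`, `𝒱 = Der A`. -/
abbrev AffineAV (k : Type*) [Field k] (n : ℕ) : Type _ :=
  DerSmashProduct k (MvPolynomial (Fin n) k)

/-- A holonomic `A𝒱`-module on `𝔸ⁿ`. -/
def IsHolonomicAV (k : Type*) [Field k] (n : ℕ) (M : Type*) [AddCommGroup M] [Module k M]
    [Module (AffineAV k n) M] [IsScalarTower k (AffineAV k n) M] : Prop :=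
  Module.Finite (AffineAV k n) M ∧
    (Subsingleton M ∨ HasGKDim k (AffineAV k n) M ((n : ℝ) : EReal))

end Holonomic

end

/-!
The growth of a module of Gelfand-Kirillov dimension `n` leaves no room for infinite chains of
submodules. The proof works over the Weyl algebra `D` inside the smash product, generated by the
coordinate functions `x i` and the partial derivatives `d i`, with the Bernstein filtration given
by the powers of `B = span {1, x i, d i}`.

* Bernstein's inequality (`le_finrank_weylSpan_pow_smul`) bounds the dimension of
  `B ^ (4 n t) v` from below by `(t + 1) ^ n`, uniformly in the `D`-module and in the nonzero
  vector `v`. Applied to the successive quotients of a chain, it turns `l` strict inclusions into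
  a dimension of at least `l (t + 1) ^ n` (`mul_le_finrank_of_chain`).

* An `A𝒱`-module `M` of Gelfand-Kirillov dimension `n` is finitely generated over `D`
  (`exists_fg_span_weylAdjoin_eq_top`). The finite-dimensional space `W` spanned by `1` and the
  vector fields of degree at most `r` satisfies `W D ⊆ D W`, because commutators with `x i` and
  `d i` do not raise degrees, and for large `r` it generates the smash product together with `D`.
  If `D W ^ j M₀` were strictly increasing in `j`, there would be `t` strict inclusions inside a
  filtration step of order `O(t)`, hence growth of degree `n + 1`. So `D W ^ j M₀` becomes constant;
  then it is stable under `D` and `W`, and equals `M`.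

* A limsup of logarithms equal to `n` does not by itself bound the growth by `K m ^ n`. For a cyclic
  `D`-module this follows from a dichotomy (`growth_dichotomy`): the exponents that are not
  leading exponents of the annihilator of the generator form a lower set, which either contains a
  coordinate orthant of dimension `n + 1`, or has at most `n` large coordinates at each of its
  points. The first case is excluded by the Gelfand-Kirillov dimension.

* Growth at most `K m ^ n` and the lower bound for chains give a bound on the length of `M` over
  `D` (`isFiniteLength_of_finrank_le`), hence finite length over the smash product.
-/

/-! ### Normal ordering in the Weyl algebra -/

/-- The defining relations of the Weyl algebra: the `x i` commute, the `d i` commute, and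
`[d i, x j] = δ_ij`. -/
structure WeylRelations {n : ℕ} {D : Type*} [Ring D] (x d : Fin n → D) : Prop where
  x_comm : ∀ i j, x i * x j = x j * x i
  d_comm : ∀ i j, d i * d j = d j * d i
  d_mul_x : ∀ i j, d i * x j = x j * d i + if i = j then 1 else 0

/-- The first step of the Bernstein filtration: the span of `1`, the `x i` and the `d i`. -/
def weylSpan (k : Type*) {D : Type*} [Field k] [Ring D] [Algebra k D] {n : ℕ} (x d : Fin n → D) :
    Submodule k D :=
  Submodule.span k ({1} ∪ (Set.range x ∪ Set.range d))

/-- `N` replaces the variables `X (inl i)` by `x i` and `X (inr i)` by `d i` and writes every `x`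
to the left of every `d`. -/
structure IsNormalOrdering {k D : Type*} [Field k] [Ring D] [Algebra k D] {n : ℕ}
    (x d : Fin n → D) (N : MvPolynomial (Fin n ⊕ Fin n) k →ₗ[k] D) : Prop where
  map_C : ∀ c, N (MvPolynomial.C c) = algebraMap k D c
  map_X_inl_mul : ∀ i p, N (MvPolynomial.X (Sum.inl i) * p) = x i * N p
  map_X_inr_mul : ∀ i p, N (MvPolynomial.X (Sum.inr i) * p) = N p * d i

section NormalOrdering

open MvPolynomial

variable {k D : Type*} [Field k] [Ring D] [Algebra k D] {n : ℕ} {x d : Fin n → D}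

theorem exists_eq_add_single {σ : Type*} {s : σ →₀ ℕ} (h : s ≠ 0) :
    ∃ t a, s = t + Finsupp.single a 1 := by
  classical
  obtain ⟨a, ha⟩ := Finsupp.ne_iff.1 h
  exact ⟨s - Finsupp.single a 1, a, (tsub_add_cancel_of_le (by
    simpa [Finsupp.single_le_iff, Nat.one_le_iff_ne_zero] using ha)).symm⟩

theorem one_mem_weylSpan : (1 : D) ∈ weylSpan k x d := Submodule.subset_span (by simp)

theorem x_mem_weylSpan (i : Fin n) : x i ∈ weylSpan k x d := Submodule.subset_span (by simp)

theorem d_mem_weylSpan (i : Fin n) : d i ∈ weylSpan k x d := Submodule.subset_span (by simp)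

theorem weylSpan_le {S : Submodule k D} (h1 : 1 ∈ S) (hx : ∀ i, x i ∈ S) (hd : ∀ i, d i ∈ S) :
    weylSpan k x d ≤ S := by
  refine Submodule.span_le.2 ?_
  rintro _ (rfl | ⟨i, rfl⟩ | ⟨i, rfl⟩)
  exacts [h1, hx i, hd i]

theorem weylSpan_fg : (weylSpan k x d).FG :=
  Submodule.fg_span ((Set.finite_singleton _).union ((Set.finite_range _).union
    (Set.finite_range _)))

open scoped IsMulCommutative in
/-- Pairwise commuting elements of a (noncommutative) algebra can be substituted into a
polynomial. -/
theorem exists_algHom_of_commute (y : Fin n → D) (hy : ∀ i j, y i * y j = y j * y i) :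
    ∃ φ : MvPolynomial (Fin n) k →ₐ[k] D, ∀ i, φ (X i) = y i := by
  have : IsMulCommutative (Algebra.adjoin k (Set.range y)) :=
    Algebra.isMulCommutative_adjoin k (by rintro _ ⟨i, rfl⟩ _ ⟨j, rfl⟩; exact hy i j)
  let f : MvPolynomial (Fin n) k →ₐ[k] Algebra.adjoin k (Set.range y) :=
    aeval fun i => ⟨y i, Algebra.subset_adjoin ⟨i, rfl⟩⟩
  exact ⟨(Algebra.adjoin k (Set.range y)).val.comp f, fun i => by simp [f]⟩

/-- The normal ordering is the map `k[X] ⊗ k[Y] → D`, `p ⊗ q ↦ p(x) q(d)`. -/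
theorem exists_isNormalOrdering (h : WeylRelations x d) :
    ∃ N : MvPolynomial (Fin n ⊕ Fin n) k →ₗ[k] D, IsNormalOrdering x d N := by
  obtain ⟨φ, hφ⟩ := exists_algHom_of_commute (k := k) x h.x_comm
  obtain ⟨ψ, hψ⟩ := exists_algHom_of_commute (k := k) d h.d_comm
  let P := MvPolynomial (Fin n) k
  let s : MvPolynomial (Fin n ⊕ Fin n) k →ₐ[k] P ⊗[k] P :=
    aeval (Sum.elim (fun i => X i ⊗ₜ 1) (fun i => 1 ⊗ₜ X i))
  let m : P ⊗[k] P →ₗ[k] D := LinearMap.mul' k D ∘ₗ TensorProduct.map φ.toLinearMap ψ.toLinearMap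
  refine ⟨m ∘ₗ s.toLinearMap, ⟨fun c => ?_, fun i p => ?_, fun i p => ?_⟩⟩
  · have : s (C c) = algebraMap k P c ⊗ₜ 1 := s.commutes c
    simp [this, m]
  · have hs : s (X (Sum.inl i)) = X i ⊗ₜ 1 := by simp [s]
    simp only [LinearMap.comp_apply, AlgHom.toLinearMap_apply, map_mul, hs]
    generalize s p = t
    induction t with
    | zero => simp
    | add a b ha hb => simp only [mul_add, map_add, ha, hb]
    | tmul a b => simp [m, hφ, mul_assoc]
  · have hs : s (X (Sum.inr i)) = 1 ⊗ₜ X i := by simp [s]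
    simp only [LinearMap.comp_apply, AlgHom.toLinearMap_apply, map_mul, hs]
    generalize s p = t
    induction t with
    | zero => simp
    | add a b ha hb => simp only [mul_add, add_mul, map_add, ha, hb]
    | tmul a b =>
      rw [Algebra.TensorProduct.tmul_mul_tmul, mul_comm (X i) b]
      simp [m, hψ, mul_assoc]

variable {N : MvPolynomial (Fin n ⊕ Fin n) k →ₗ[k] D}

theorem IsNormalOrdering.map_pderiv_inl (h : WeylRelations x d) (hN : IsNormalOrdering x d N)
    (j : Fin n) (p : MvPolynomial (Fin n ⊕ Fin n) k) :
    N (pderiv (Sum.inl j) p) = d j * N p - N p * d j := by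
  classical
  induction p using MvPolynomial.induction_on with
  | C c => simp [hN.map_C, Algebra.commutes]
  | add p q hp hq => simp only [map_add, hp, hq, mul_add, add_mul]; abel
  | mul_X p i hp =>
    rw [mul_comm p, Derivation.leibniz, smul_eq_mul, smul_eq_mul, map_add]
    rcases i with i | i
    · rw [hN.map_X_inl_mul, hN.map_X_inl_mul, hp, pderiv_X, ← mul_assoc (d j), h.d_mul_x]
      by_cases hij : j = i
      · subst hij; simp [mul_sub, add_mul, mul_assoc]; abel
      · have : (Sum.inl i : Fin n ⊕ Fin n) ≠ Sum.inl j := fun e => hij (Sum.inl.inj e).symm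
        simp [hij, mul_sub, mul_assoc, Ne.symm this]
    · rw [hN.map_X_inr_mul, hN.map_X_inr_mul, hp, pderiv_X]
      simp [sub_mul, mul_assoc, h.d_comm]

theorem IsNormalOrdering.map_pderiv_inr (h : WeylRelations x d) (hN : IsNormalOrdering x d N)
    (j : Fin n) (p : MvPolynomial (Fin n ⊕ Fin n) k) :
    N (pderiv (Sum.inr j) p) = N p * x j - x j * N p := by
  classical
  induction p using MvPolynomial.induction_on with
  | C c => simp [hN.map_C, Algebra.commutes]
  | add p q hp hq => simp only [map_add, hp, hq, mul_add, add_mul]; abel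
  | mul_X p i hp =>
    rw [mul_comm p, Derivation.leibniz, smul_eq_mul, smul_eq_mul, map_add]
    rcases i with i | i
    · rw [hN.map_X_inl_mul, hN.map_X_inl_mul, hp, pderiv_X, ← mul_assoc (x j), h.x_comm j i]
      simp [mul_sub, mul_assoc]
    · rw [hN.map_X_inr_mul, hN.map_X_inr_mul, hp, pderiv_X, mul_assoc (N p) (d i), h.d_mul_x]
      by_cases hij : i = j
      · subst hij; simp [sub_mul, mul_add, mul_assoc]; abel
      · simp [hij, sub_mul, mul_assoc]

/-- Normally ordered polynomials of degree at most `i` lie in step `i` of the Bernstein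
filtration. -/
theorem IsNormalOrdering.map_mem_weylSpan_pow (hN : IsNormalOrdering x d N) {i : ℕ}
    {p : MvPolynomial (Fin n ⊕ Fin n) k} (hp : p ∈ restrictSupport k {s | s.degree ≤ i}) :
    N p ∈ weylSpan k x d ^ i := by
  have key : ∀ (i : ℕ) (s : Fin n ⊕ Fin n →₀ ℕ), s.degree ≤ i →
      N (monomial s 1) ∈ weylSpan k x d ^ i := by
    intro i
    induction i with
    | zero =>
      intro s hs
      have : s = 0 := (Finsupp.degree_eq_zero_iff s).1 (Nat.le_zero.1 hs)
      subst this
      have := hN.map_C 1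
      rw [C_apply] at this
      rw [this, pow_zero, map_one]
      exact Submodule.one_le.1 le_rfl
    | succ i ih =>
      intro s hs
      by_cases h0 : s = 0
      · subst h0
        have := hN.map_C 1
        rw [C_apply] at this
        rw [this, map_one]
        exact Submodule.one_le.1 (one_le_pow_of_one_le' (Submodule.one_le.2 one_mem_weylSpan) _)
      · obtain ⟨t, a, rfl⟩ := exists_eq_add_single h0
        have ht : t.degree ≤ i := by simpa using hs
        have e : monomial (t + Finsupp.single a 1) (1 : k) = X a * monomial t 1 := by
          rw [X, monomial_mul, add_comm, one_mul]
        rw [e]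
        rcases a with a | a
        · rw [hN.map_X_inl_mul, pow_succ']
          exact Submodule.mul_mem_mul (x_mem_weylSpan a) (ih t ht)
        · rw [hN.map_X_inr_mul, pow_succ]
          exact Submodule.mul_mem_mul (ih t ht) (d_mem_weylSpan a)
  rw [restrictSupport_eq_span] at hp
  refine Submodule.span_le.2 ?_ hp |> fun h : p ∈ (weylSpan k x d ^ i).comap N => h
  rintro _ ⟨s, hs, rfl⟩
  exact key i s hs

/-- Step `i` of the Bernstein filtration consists of normally ordered polynomials of degree at
most `i`. -/
theorem IsNormalOrdering.weylSpan_pow_le (h : WeylRelations x d) (hN : IsNormalOrdering x d N)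
    (i : ℕ) : weylSpan k x d ^ i ≤ (restrictSupport k {s | s.degree ≤ i}).map N := by
  have hX : ∀ (a : Fin n ⊕ Fin n) (i : ℕ) (p : MvPolynomial (Fin n ⊕ Fin n) k),
      p ∈ restrictSupport k {s | s.degree ≤ i} →
        X a * p ∈ restrictSupport k {s | s.degree ≤ i + 1} := by
    intro a i p hp
    rw [mem_restrictSupport_iff] at hp ⊢
    intro s hs
    rw [mul_comm, Finset.mem_coe, support_mul_X] at hs
    obtain ⟨t, ht, rfl⟩ := Finset.mem_map.1 hs
    have := hp ht
    simpa using this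
  have hder : ∀ (a : Fin n ⊕ Fin n) (i : ℕ) (p : MvPolynomial (Fin n ⊕ Fin n) k),
      p ∈ restrictSupport k {s | s.degree ≤ i} →
        pderiv a p ∈ restrictSupport k {s | s.degree ≤ i + 1} := by
    intro a i p hp
    rw [mem_restrictSupport_iff] at hp ⊢
    intro s hs
    rw [Finset.mem_coe, mem_support_iff, coeff_pderiv] at hs
    have := hp (mem_support_iff.2 (left_ne_zero_of_mul hs))
    simp only [Set.mem_ofPred_eq, map_add, Finsupp.degree_single] at this ⊢
    lia
  induction i with
  | zero =>
    rw [pow_zero, Submodule.one_le]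
    refine ⟨C 1, ?_, by rw [hN.map_C, map_one]⟩
    rw [C_apply]
    exact (monomial_mem_restrictSupport k).2 (Or.inl (by simp))
  | succ i ih =>
    rw [pow_succ']
    refine (mul_le_mul_right ih _).trans (Submodule.mul_le.2 fun b hb c hc => ?_)
    obtain ⟨p, hp, rfl⟩ := hc
    suffices weylSpan k x d ≤ ((restrictSupport k {s | s.degree ≤ i + 1}).map N).comap
        (LinearMap.mulRight k (N p)) from this hb
    refine weylSpan_le ?_ (fun j => ?_) (fun j => ?_)
    · exact ⟨p, restrictSupport_mono _ (fun s hs => Nat.le_succ_of_le hs) hp, by simp⟩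
    · exact ⟨_, hX (Sum.inl j) i p hp, by simp [hN.map_X_inl_mul]⟩
    · exact ⟨_, add_mem (hX (Sum.inr j) i p hp) (hder (Sum.inl j) i p hp), by
        simp [hN.map_X_inr_mul, hN.map_pderiv_inl h]⟩

end NormalOrdering

/-! ### Boxes of monomials -/

section Box

open MvPolynomial

/-- The exponent that is `t` on `T` and `0` elsewhere. -/
noncomputable def boxCorner {σ : Type*} [Fintype σ] [DecidableEq σ] (T : Finset σ) (t : ℕ) :
    σ →₀ ℕ :=
  Finsupp.equivFunOnFinite.symm fun a => if a ∈ T then t else 0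

variable {σ : Type*} [Fintype σ] [DecidableEq σ] (T : Finset σ) (t : ℕ)

theorem boxCorner_apply (a : σ) : boxCorner T t a = if a ∈ T then t else 0 := rfl

theorem degree_boxCorner : (boxCorner T t).degree = T.card * t := by
  simp [Finsupp.degree_eq_sum, boxCorner_apply, Finset.sum_ite_mem]

theorem card_Iic_boxCorner : (Finset.Iic (boxCorner T t)).card = (t + 1) ^ T.card := by
  rw [Finsupp.card_Iic, Finset.prod_subset (Finset.subset_univ _) (by
    intro a _ ha; simp [Finsupp.notMem_support_iff.1 ha])]
  simp only [boxCorner_apply, Nat.card_Iic]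
  rw [← Finset.prod_subset (Finset.subset_univ T) (by intro a _ ha; simp [ha])]
  rw [Finset.prod_congr rfl (fun a ha => by rw [if_pos ha]), Finset.prod_const]

variable (k : Type*) [Field k]

theorem finrank_restrictSupport_boxCorner :
    Module.finrank k (restrictSupport k (Set.Iic (boxCorner T t))) = (t + 1) ^ T.card := by
  rw [Module.finrank_eq_nat_card_basis (basisRestrictSupport k _), ← card_Iic_boxCorner]
  rw [← Finset.coe_Iic]
  simp

instance finite_restrictSupport_boxCorner :
    Module.Finite k (restrictSupport k (Set.Iic (boxCorner T t))) :=
  have : Finite (Set.Iic (boxCorner T t)) := Set.Finite.to_subtype (Set.finite_Iic _)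
  Module.Finite.of_basis (basisRestrictSupport k _)

theorem restrictSupport_boxCorner_le :
    restrictSupport k (Set.Iic (boxCorner T t)) ≤
      restrictSupport k {s | s.degree ≤ T.card * t} :=
  restrictSupport_mono _ fun s hs => by
    rw [Set.mem_ofPred_eq, ← degree_boxCorner]
    exact Finsupp.degree_mono hs

end Box

/-! ### Bernstein's inequality -/

theorem smul_fg {k R M : Type*} [Field k] [Ring R] [Algebra k R] [AddCommGroup M] [Module k M]
    [Module R M] [IsScalarTower k R M] {I : Submodule k R} {F : Submodule k M} (hI : I.FG)
    (hF : F.FG) : (I • F).FG := by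
  have : I • F = Submodule.map₂ (Algebra.lsmul k k M).toLinearMap I F :=
    le_antisymm (Submodule.smul_le.2 fun r hr m hm => Submodule.apply_mem_map₂ _ hr hm)
      (Submodule.map₂_le.2 fun r hr m hm => Submodule.smul_mem_smul hr hm)
  rw [this]
  exact hI.map₂ _ hF

section Bernstein

open MvPolynomial

theorem eq_C_of_pderiv_eq_zero {k σ : Type*} [Field k] [CharZero k] {p : MvPolynomial σ k}
    (hp : ∀ a, pderiv a p = 0) : p = C (coeff 0 p) := by
  classical
  ext s
  rw [coeff_C]
  split_ifs with h
  · rw [h]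
  · obtain ⟨t, a, rfl⟩ := exists_eq_add_single (Ne.symm h)
    have h0 := coeff_pderiv (i := a) p t
    rw [hp a, coeff_zero] at h0
    exact (mul_eq_zero.1 h0.symm).resolve_right (Nat.cast_add_one_ne_zero _)

variable {k D : Type*} [Field k] [Ring D] [Algebra k D] {n : ℕ} {x d : Fin n → D}
  {N : MvPolynomial (Fin n ⊕ Fin n) k →ₗ[k] D}
  {Q : Type*} [AddCommGroup Q] [Module k Q] [Module D Q] [IsScalarTower k D Q]

/-- A nonzero operator of order at most `i` in the Bernstein filtration does not annihilate step
`i` of the filtration generated by a nonzero vector. Commutators with `x j` and `d j` lower the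
order, so by induction an annihilating operator is central, that is, a scalar. -/
theorem eq_zero_of_smul_weylSpan_pow_eq_zero [CharZero k] (h : WeylRelations x d)
    (hN : IsNormalOrdering x d N) {v : Q} (hv : v ≠ 0) (i : ℕ) :
    ∀ p ∈ restrictSupport k {s : Fin n ⊕ Fin n →₀ ℕ | s.degree ≤ i},
      (∀ a ∈ weylSpan k x d ^ i, N p • a • v = 0) → p = 0 := by
  have h1 : ∀ i, (1 : D) ∈ weylSpan k x d ^ i := fun i =>
    Submodule.one_le.1 (one_le_pow_of_one_le' (Submodule.one_le.2 one_mem_weylSpan) _)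
  have final : ∀ i, ∀ p : MvPolynomial (Fin n ⊕ Fin n) k, (∀ a, pderiv a p = 0) →
      (∀ a ∈ weylSpan k x d ^ i, N p • a • v = 0) → p = 0 := by
    intro i p hp H
    have hC := eq_C_of_pderiv_eq_zero hp
    have := H 1 (h1 i)
    rw [hC, hN.map_C, one_smul, algebraMap_smul, smul_eq_zero, or_iff_left hv] at this
    rw [hC, this, C_0]
  induction i with
  | zero =>
    refine fun p hp H => final 0 p (fun a => ?_) H
    ext s
    rw [coeff_pderiv, coeff_zero]
    by_contra hs
    have := (mem_restrictSupport_iff k).1 hp (mem_support_iff.2 (left_ne_zero_of_mul hs))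
    simp at this
  | succ i ih =>
    refine fun p hp H => final (i + 1) p (fun a => ih _ ?_ fun b hb => ?_) H
    · rw [mem_restrictSupport_iff] at hp ⊢
      intro s hs
      rw [Finset.mem_coe, mem_support_iff, coeff_pderiv] at hs
      have := hp (mem_support_iff.2 (left_ne_zero_of_mul hs))
      simpa using this
    · have hb' : b ∈ weylSpan k x d ^ (i + 1) :=
        pow_le_pow_right' (Submodule.one_le.2 one_mem_weylSpan) (Nat.le_succ i) hb
      rcases a with j | j
      · have := H _ (by rw [pow_succ']; exact Submodule.mul_mem_mul (d_mem_weylSpan j) hb)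
        rw [hN.map_pderiv_inl h, sub_smul, mul_smul, mul_smul, H b hb', smul_zero, zero_sub,
          ← mul_smul (d j), this, neg_zero]
      · have := H _ (by rw [pow_succ']; exact Submodule.mul_mem_mul (x_mem_weylSpan j) hb)
        rw [hN.map_pderiv_inr h, sub_smul, mul_smul, mul_smul, H b hb', smul_zero, sub_zero,
          ← mul_smul (x j), this]

/-- Bernstein's inequality, with a bound that is uniform in the module and in the nonzero
vector `v`. The operators with exponents at most `t` in each of the `2 n` variables form a space of
dimension `(t + 1) ^ (2 n)`, which embeds in the linear maps from `B ^ (2 n t) v` to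
`B ^ (4 n t) v`. -/
theorem le_finrank_weylSpan_pow_smul [CharZero k] (h : WeylRelations x d) {v : Q} (hv : v ≠ 0)
    (t : ℕ) :
    (t + 1) ^ n ≤ Module.finrank k ↥(weylSpan k x d ^ (4 * n * t) • Submodule.span k {v}) := by
  obtain ⟨N, hN⟩ := exists_isNormalOrdering (k := k) h
  let B := weylSpan k x d
  let V := B ^ (2 * n * t) • Submodule.span k {v}
  let W := B ^ (4 * n * t) • Submodule.span k {v}
  let P := restrictSupport k (Set.Iic (boxCorner (Finset.univ : Finset (Fin n ⊕ Fin n)) t))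
  have : Module.Finite k V :=
    Module.Finite.iff_fg.2 (smul_fg (weylSpan_fg.pow _) (Submodule.fg_span_singleton v))
  have : Module.Finite k W :=
    Module.Finite.iff_fg.2 (smul_fg (weylSpan_fg.pow _) (Submodule.fg_span_singleton v))
  have hP : P ≤ restrictSupport k {s | s.degree ≤ 2 * n * t} := by
    have := restrictSupport_boxCorner_le (Finset.univ : Finset (Fin n ⊕ Fin n)) t k
    simpa [two_mul] using this
  have hPN : ∀ p ∈ P, ∀ w ∈ V, N p • w ∈ W := by
    intro p hp w hw
    have : N p • w ∈ B ^ (2 * n * t) • V :=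
      Submodule.smul_mem_smul (hN.map_mem_weylSpan_pow (hP hp)) hw
    rw [← Submodule.smul_assoc, smul_eq_mul, ← pow_add] at this
    convert this using 3
    ring
  let Φ : P →ₗ[k] V →ₗ[k] W :=
    { toFun := fun p => (Algebra.lsmul k k Q (N p)).restrict (hPN p p.2)
      map_add' := fun p q => by
        ext w
        change N (p + q) • (w : Q) = N p • (w : Q) + N q • (w : Q)
        rw [map_add, add_smul]
      map_smul' := fun c p => by
        ext w
        change N (c • p) • (w : Q) = c • N p • (w : Q)
        rw [map_smul, smul_assoc] }
  have hΦ : Function.Injective Φ := by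
    rw [← LinearMap.ker_eq_bot, LinearMap.ker_eq_bot']
    intro p hp
    refine Subtype.ext (eq_zero_of_smul_weylSpan_pow_eq_zero h hN hv _ p (hP p.2) fun a ha => ?_)
    have := LinearMap.congr_fun hp
      ⟨a • v, Submodule.smul_mem_smul ha (Submodule.mem_span_singleton_self v)⟩
    exact congrArg Subtype.val this
  have hVW : V ≤ W := Submodule.smul_mono_left
    (pow_le_pow_right' (Submodule.one_le.2 one_mem_weylSpan) (by gcongr; norm_num))
  have h1 := LinearMap.finrank_le_finrank_of_injective hΦ
  rw [Module.finrank_linearMap, finrank_restrictSupport_boxCorner] at h1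
  have h2 := h1.trans (Nat.mul_le_mul_right _ (Submodule.finrank_mono hVW))
  simp only [Finset.card_univ, Fintype.card_sum, Fintype.card_fin, pow_add] at h2
  exact Nat.mul_self_le_mul_self_iff.1 h2

/-- Every strict inclusion in a chain of submodules contributes to the dimension of a subspace `G`
that contains the filtration steps generated by vectors witnessing the strictness. -/
theorem mul_le_finrank_of_chain [CharZero k] (h : WeylRelations x d) (t : ℕ) {G : Submodule k Q}
    (hG : G.FG) (S : ℕ → Submodule D Q) (v : ℕ → Q) (l : ℕ) (hS : Monotone S)
    (hv : ∀ i < l, v i ∈ S (i + 1)) (hv' : ∀ i < l, v i ∉ S i)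
    (hvG : ∀ i < l, weylSpan k x d ^ (4 * n * t) • Submodule.span k {v i} ≤ G) :
    l * (t + 1) ^ n ≤ Module.finrank k G := by
  have : Module.Finite k G := Module.Finite.iff_fg.2 hG
  have key : ∀ j ≤ l, j * (t + 1) ^ n ≤
      Module.finrank k ↥(G ⊓ (S j).restrictScalars k) := by
    intro j
    induction j with
    | zero => simp
    | succ j ih =>
      intro hj
      have ih := ih (Nat.le_of_succ_le hj)
      let q : Q →ₗ[k] Q ⧸ S j := (S j).mkQ.restrictScalars k
      let H := G ⊓ (S (j + 1)).restrictScalars k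
      let f : H →ₗ[k] Q ⧸ S j := q.domRestrict H
      have : Module.Finite k H := Submodule.finiteDimensional_inf_left _ _
      have hf := f.finrank_range_add_finrank_ker
      have hker : Module.finrank k ↥(G ⊓ (S j).restrictScalars k) ≤
          Module.finrank k (LinearMap.ker f) := by
        refine LinearMap.finrank_le_finrank_of_injective
          (f := LinearMap.codRestrict _ (Submodule.inclusion
            (inf_le_inf_left G fun y hy => hS (Nat.le_succ j) hy)) fun y => ?_) ?_
        · rw [LinearMap.mem_ker]
          exact (Submodule.Quotient.mk_eq_zero _).2 y.2.2
        · intro y z hyz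
          exact Subtype.ext (congrArg (fun w => ((w : LinearMap.ker f) : H).1) hyz)
      have hrange : (t + 1) ^ n ≤ Module.finrank k (LinearMap.range f) := by
        have hvj : q (v j) ≠ 0 := fun h0 => hv' j hj ((Submodule.Quotient.mk_eq_zero _).1 h0)
        refine (le_finrank_weylSpan_pow_smul h hvj t).trans (Submodule.finrank_mono ?_)
        refine Submodule.smul_le.2 fun r hr m hm => ?_
        obtain ⟨c, rfl⟩ := Submodule.mem_span_singleton.1 hm
        refine ⟨⟨r • c • v j, hvG j hj (Submodule.smul_mem_smul hr
          (Submodule.smul_mem _ _ (Submodule.mem_span_singleton_self _))),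
          (S (j + 1)).smul_mem _ (Submodule.smul_of_tower_mem _ c (hv j hj))⟩, ?_⟩
        simp [f, q]
      calc (j + 1) * (t + 1) ^ n = (t + 1) ^ n + j * (t + 1) ^ n := by ring
        _ ≤ _ := (Nat.add_le_add hrange (ih.trans hker)).trans hf.le
  exact (key l le_rfl).trans (Submodule.finrank_mono inf_le_left)

end Bernstein

/-! ### Growth of cyclic modules -/

section Growth

open MvPolynomial

/-- An upper set of exponents that meets every coordinate subspace of dimension `j + 1` omits at
most polynomially many, of degree `j`, exponents: an omitted exponent has at most `j` large
coordinates. -/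
theorem exists_ncard_diff_le {σ : Type*} [Fintype σ] [DecidableEq σ] {L : Set (σ →₀ ℕ)}
    (hL : IsUpperSet L) (j : ℕ)
    (h : ∀ T : Finset σ, T.card = j + 1 → ∃ t, boxCorner T t ∈ L) :
    ∃ K, ∀ r, ({s : σ →₀ ℕ | s.degree ≤ r} \ L).Finite ∧
      ({s : σ →₀ ℕ | s.degree ≤ r} \ L).ncard ≤ K * (r + 1) ^ j := by
  choose! τ hτ using h
  -- A side length that works for all coordinate subspaces of dimension `j + 1`.
  let t₀ := (Finset.univ : Finset (Finset σ)).sup τ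
  have ht₀ : ∀ T : Finset σ, T.card = j + 1 → boxCorner T t₀ ∈ L := by
    refine fun T hT => hL (fun a => ?_) (hτ T hT)
    rw [boxCorner_apply, boxCorner_apply]
    split_ifs
    · exact Finset.le_sup (f := τ) (Finset.mem_univ T)
    · exact le_rfl
  let f : ℕ → Finset σ → (σ →₀ ℕ) := fun r T =>
    Finsupp.equivFunOnFinite.symm fun a => if a ∈ T then r else t₀
  have hf : ∀ r T a, f r T a = if a ∈ T then r else t₀ := fun _ _ _ => rfl
  let U : ℕ → Finset (σ →₀ ℕ) := fun r =>
    (Finset.univ.filter fun T : Finset σ => T.card ≤ j).biUnion fun T => Finset.Iic (f r T)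
  have hsub : ∀ r, ({s : σ →₀ ℕ | s.degree ≤ r} \ L) ⊆ (U r : Set (σ →₀ ℕ)) := by
    rintro r s ⟨hs, hsL⟩
    let T := Finset.univ.filter fun a => t₀ < s a
    have hT : T.card ≤ j := by
      by_contra! hlt
      obtain ⟨T', hT', hc⟩ := Finset.exists_subset_card_eq (Nat.succ_le_of_lt hlt)
      refine hsL (hL (fun a => ?_) (ht₀ T' hc))
      rw [boxCorner_apply]
      split_ifs with ha
      · exact ((Finset.mem_filter.1 (hT' ha)).2).le
      · exact Nat.zero_le _
    simp only [U, Finset.coe_biUnion, Set.mem_iUnion]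
    refine ⟨T, by simpa using hT, ?_⟩
    rw [Finset.coe_Iic, Set.mem_Iic]
    intro a
    rw [hf]
    split_ifs with ha
    · exact (Finsupp.le_degree a s).trans hs
    · simpa [T] using ha
  refine ⟨2 ^ Fintype.card σ * (t₀ + 1) ^ Fintype.card σ, fun r =>
    ⟨(U r).finite_toSet.subset (hsub r), ?_⟩⟩
  calc _ ≤ (U r).card := by
        rw [← Set.ncard_coe_finset]; exact Set.ncard_le_ncard (hsub r) (U r).finite_toSet
    _ ≤ ∑ T ∈ Finset.univ.filter (fun T : Finset σ => T.card ≤ j), (Finset.Iic (f r T)).card :=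
        Finset.card_biUnion_le
    _ ≤ ∑ _T ∈ Finset.univ.filter (fun T : Finset σ => T.card ≤ j),
          (t₀ + 1) ^ Fintype.card σ * (r + 1) ^ j := by
        refine Finset.sum_le_sum fun T hT => ?_
        rw [Finsupp.card_Iic, Finset.prod_subset (Finset.subset_univ _) (by
          intro a _ ha; simp [Finsupp.notMem_support_iff.1 ha])]
        simp only [hf, Nat.card_Iic]
        calc ∏ a, ((if a ∈ T then r else t₀) + 1)
            ≤ ∏ a, ((t₀ + 1) * if a ∈ T then r + 1 else 1) := by
              refine Finset.prod_le_prod' fun a _ => ?_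
              split_ifs
              · exact Nat.le_mul_of_pos_left _ (Nat.succ_pos _)
              · simp
          _ = (t₀ + 1) ^ Fintype.card σ * (r + 1) ^ T.card := by
              rw [Finset.prod_mul_distrib]
              simp [Finset.prod_ite_mem]
          _ ≤ _ := by
              gcongr
              · exact Nat.succ_pos r
              · exact (Finset.mem_filter.1 hT).2
    _ ≤ 2 ^ Fintype.card σ * ((t₀ + 1) ^ Fintype.card σ * (r + 1) ^ j) := by
        rw [Finset.sum_const, smul_eq_mul]
        refine Nat.mul_le_mul_right _ ((Finset.card_le_univ _).trans ?_)
        simp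
    _ = _ := (mul_assoc _ _ _).symm

theorem exists_degree_monomialOrder (σ : Type) [Finite σ] :
    ∃ m : MonomialOrder.{0, 0} σ, ∀ s t : σ →₀ ℕ, m.toSyn s ≤ m.toSyn t → s.degree ≤ t.degree := by
  obtain ⟨r, ⟨e⟩⟩ := Finite.exists_equiv_fin σ
  let : LinearOrder σ := LinearOrder.lift' e e.injective
  refine ⟨MonomialOrder.degLex, fun s t hst => ?_⟩
  rw [MonomialOrder.degLex_le_iff] at hst
  exact Finsupp.DegLex.monotone_degree hst

variable {k D : Type*} [Field k] [Ring D] [Algebra k D] {n : ℕ} {x d : Fin n → D}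
  {N : MvPolynomial (Fin n ⊕ Fin n) k →ₗ[k] D}
  {Q : Type*} [AddCommGroup Q] [Module k Q] [Module D Q] [IsScalarTower k D Q]

/-- The leading exponents of the nonzero normally ordered operators that annihilate `v`. -/
def leadingExponents (m : MonomialOrder (Fin n ⊕ Fin n))
    (N : MvPolynomial (Fin n ⊕ Fin n) k →ₗ[k] D) (v : Q) : Set (Fin n ⊕ Fin n →₀ ℕ) :=
  {s | ∃ p, N p • v = 0 ∧ p ≠ 0 ∧ m.degree p = s}

omit [Module k Q] [IsScalarTower k D Q] in
theorem isUpperSet_leadingExponents (m : MonomialOrder (Fin n ⊕ Fin n)) (h : WeylRelations x d)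
    (hN : IsNormalOrdering x d N) (v : Q) : IsUpperSet (leadingExponents m N v) := by
  have hstep : ∀ s ∈ leadingExponents m N v, ∀ a,
      s + Finsupp.single a 1 ∈ leadingExponents m N v := by
    rintro _ ⟨p, hp, hp0, rfl⟩ a
    have hX : (X a : MvPolynomial (Fin n ⊕ Fin n) k) * p ≠ 0 := mul_ne_zero (X_ne_zero a) hp0
    have hdeg : m.degree (X a * p) = m.degree p + Finsupp.single a 1 := by
      rw [MonomialOrder.degree_mul (X_ne_zero a) hp0, MonomialOrder.degree_X, add_comm]
    rcases a with j | j
    · exact ⟨_, by rw [hN.map_X_inl_mul, mul_smul, hp, smul_zero], hX, hdeg⟩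
    · -- `d j * N p` is the normal ordering of `X (inr j) * p + pderiv (inl j) p`,
      -- and the second summand does not affect the leading exponent.
      have hpos : m.toSyn 0 < m.toSyn (m.degree p + Finsupp.single (Sum.inr j) 1) := by
        rw [map_zero, MonomialOrder.toSyn_lt_iff_ne_zero, Ne, MonomialOrder.toSyn_eq_zero_iff]
        simp
      have hlt : m.toSyn (m.degree (pderiv (Sum.inl j) p)) < m.toSyn (m.degree
          (X (Sum.inr j) * p)) := by
        rw [hdeg, MonomialOrder.degree_lt_iff hpos]
        intro c hc
        rw [mem_support_iff, coeff_pderiv] at hc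
        have h1 := m.le_degree (mem_support_iff.2 (left_ne_zero_of_mul hc))
        calc m.toSyn c ≤ m.toSyn (c + Finsupp.single (Sum.inl j) 1) :=
              m.toSyn_monotone le_self_add
          _ ≤ m.toSyn (m.degree p) := h1
          _ < _ := m.toSyn_strictMono (lt_add_of_pos_right _ (by simp [pos_iff_ne_zero]))
      have hdeg' := MonomialOrder.degree_add_of_lt hlt
      refine ⟨_, ?_, fun h0 => ?_, hdeg'.trans hdeg⟩
      · rw [map_add, hN.map_X_inr_mul, hN.map_pderiv_inl h, add_sub_cancel, mul_smul, hp,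
          smul_zero]
      · rw [h0, MonomialOrder.degree_zero] at hdeg'
        rw [← hdeg'] at hlt
        exact absurd hlt (by simp)
  intro s s' hss hs
  obtain ⟨u, rfl⟩ := exists_add_of_le hss
  clear hss
  induction hr : u.degree generalizing u with
  | zero => rwa [(Finsupp.degree_eq_zero_iff u).1 hr, add_zero]
  | succ r ih =>
    obtain ⟨t, a, rfl⟩ := exists_eq_add_single (s := u) (by rintro rfl; simp at hr)
    rw [← add_assoc]
    exact hstep _ (ih t (by simpa using hr)) a

/-- Modulo the annihilator of `v`, a normally ordered polynomial is a combination of monomials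
that are not leading exponents of the annihilator. -/
theorem weylSpan_pow_smul_le_map {m : MonomialOrder (Fin n ⊕ Fin n)}
    (hm : ∀ s t : Fin n ⊕ Fin n →₀ ℕ, m.toSyn s ≤ m.toSyn t → s.degree ≤ t.degree)
    (h : WeylRelations x d) (hN : IsNormalOrdering x d N) (v : Q) (r : ℕ) :
    weylSpan k x d ^ r • Submodule.span k {v} ≤
      (restrictSupport k ({s | s.degree ≤ r} \ leadingExponents m N v)).map
        (((LinearMap.toSpanSingleton D Q v).restrictScalars k).comp N) := by
  set S := (restrictSupport k ({s | s.degree ≤ r} \ leadingExponents m N v)).map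
        (((LinearMap.toSpanSingleton D Q v).restrictScalars k).comp N) with hS
  have key : ∀ (y : m.syn) (s : Fin n ⊕ Fin n →₀ ℕ), m.toSyn s = y → s.degree ≤ r →
      N (monomial s 1) • v ∈ S := by
    intro y
    induction y using WellFoundedLT.induction with
    | ind y ih =>
      rintro s rfl hs
      by_cases hsL : s ∈ leadingExponents m N v
      · obtain ⟨p, hp, hp0, rfl⟩ := hsL
        have hc : m.leadingCoeff p ≠ 0 := MonomialOrder.leadingCoeff_ne_zero_iff.2 hp0
        -- Subtracting `p` from its leading term leaves only smaller monomials.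
        have hrest : ∀ q ∈ restrictSupport k {t | m.toSyn t < m.toSyn (m.degree p)},
            N q • v ∈ S := by
          intro q hq
          rw [restrictSupport_eq_span] at hq
          refine Submodule.span_le (p := S.comap
            (((LinearMap.toSpanSingleton D Q v).restrictScalars k).comp N)).2 ?_ hq
          rintro _ ⟨t, ht, rfl⟩
          exact ih _ ht t rfl ((hm _ _ (le_of_lt ht)).trans hs)
        have hq := hrest (p - monomial (m.degree p) (m.leadingCoeff p)) (by
          rw [mem_restrictSupport_iff]
          intro t ht
          rw [Finset.mem_coe, mem_support_iff, coeff_sub, coeff_monomial] at ht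
          by_cases e : m.degree p = t
          · subst e
            simp [MonomialOrder.leadingCoeff] at ht
          · rw [if_neg e, sub_zero] at ht
            exact lt_of_le_of_ne (m.le_degree (mem_support_iff.2 ht))
              fun e' => e (m.toSyn.injective e').symm)
        have e : monomial (m.degree p) (m.leadingCoeff p) =
            m.leadingCoeff p • monomial (m.degree p) (1 : k) := by rw [smul_monomial]; simp
        rw [map_sub, sub_smul, hp, zero_sub, neg_mem_iff, e, map_smul, smul_assoc] at hq
        exact (Submodule.smul_mem_iff S hc).1 hq
      · exact ⟨_, (monomial_mem_restrictSupport k).2 (Or.inl ⟨hs, hsL⟩), rfl⟩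
  refine Submodule.smul_le.2 fun b hb w hw => ?_
  obtain ⟨c, rfl⟩ := Submodule.mem_span_singleton.1 hw
  obtain ⟨p, hp, rfl⟩ := hN.weylSpan_pow_le h r hb
  rw [smul_comm]
  refine S.smul_mem c ?_
  rw [SetLike.mem_coe, restrictSupport_eq_span] at hp
  refine Submodule.span_le (p := S.comap
    (((LinearMap.toSpanSingleton D Q v).restrictScalars k).comp N)).2 ?_ hp
  rintro _ ⟨t, ht, rfl⟩
  exact key _ t rfl ht

/-- The growth of a cyclic module along the Bernstein filtration is either at most polynomial of
degree `j` or at least polynomial of degree `j + 1`. -/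
theorem growth_dichotomy (h : WeylRelations x d) (v : Q) (j : ℕ) :
    (∀ t, (t + 1) ^ (j + 1) ≤
      Module.finrank k ↥(weylSpan k x d ^ ((j + 1) * t) • Submodule.span k {v})) ∨
    ∃ K, ∀ r, Module.finrank k ↥(weylSpan k x d ^ r • Submodule.span k {v}) ≤
      K * (r + 1) ^ j := by
  obtain ⟨N, hN⟩ := exists_isNormalOrdering (k := k) h
  obtain ⟨m, hm⟩ := exists_degree_monomialOrder (Fin n ⊕ Fin n)
  let L := leadingExponents m N v
  have hL : IsUpperSet L := isUpperSet_leadingExponents m h hN v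
  let g := ((LinearMap.toSpanSingleton D Q v).restrictScalars k).comp N
  by_cases hT : ∀ T : Finset (Fin n ⊕ Fin n), T.card = j + 1 → ∃ t, boxCorner T t ∈ L
  · right
    obtain ⟨K, hK⟩ := exists_ncard_diff_le hL j hT
    refine ⟨K, fun r => ?_⟩
    obtain ⟨hfin, hcard⟩ := hK r
    have := hfin.to_subtype
    have : Module.Finite k (restrictSupport k ({s | s.degree ≤ r} \ L)) :=
      Module.Finite.of_basis (basisRestrictSupport k _)
    calc _ ≤ Module.finrank k ↥((restrictSupport k ({s | s.degree ≤ r} \ L)).map g) :=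
          Submodule.finrank_mono (weylSpan_pow_smul_le_map hm h hN v r)
      _ ≤ Module.finrank k (restrictSupport k ({s | s.degree ≤ r} \ L)) :=
          Submodule.finrank_map_le g _
      _ = ({s | s.degree ≤ r} \ L).ncard := by
          rw [Module.finrank_eq_nat_card_basis (basisRestrictSupport k _), Nat.card_coe_set_eq]
      _ ≤ _ := hcard
  · left
    push Not at hT
    obtain ⟨T, hTc, hTL⟩ := hT
    intro t
    let V := weylSpan k x d ^ ((j + 1) * t) • Submodule.span k {v}
    have : Module.Finite k V :=
      Module.Finite.iff_fg.2 (smul_fg (weylSpan_fg.pow _) (Submodule.fg_span_singleton v))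
    have hfr := finrank_restrictSupport_boxCorner T t k
    rw [hTc] at hfr
    rw [← hfr]
    -- An operator in the box that annihilates `v` would have its leading exponent in the box.
    refine LinearMap.finrank_le_finrank_of_injective (M' := V)
      (f := (g.domRestrict (restrictSupport k (Set.Iic (boxCorner T t)))).codRestrict V
        fun p => ?_) ?_
    · refine Submodule.smul_mem_smul (hN.map_mem_weylSpan_pow ?_)
        (Submodule.mem_span_singleton_self v)
      rw [← hTc]
      exact restrictSupport_boxCorner_le T t k p.2
    · rw [← LinearMap.ker_eq_bot, LinearMap.ker_eq_bot']
      intro p hp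
      by_contra hp0
      have hp1 : (p : MvPolynomial (Fin n ⊕ Fin n) k) ≠ 0 := fun e => hp0 (Subtype.ext e)
      exact hTL t (hL ((mem_restrictSupport_iff k).1 p.2 (m.degree_mem_support hp1))
        ⟨p, congrArg Subtype.val hp, hp1, rfl⟩)

end Growth

theorem mul_smul_eq {k R M : Type*} [Field k] [Ring R] [Algebra k R] [AddCommGroup M]
    [Module k M] [Module R M] [IsScalarTower k R M] (I J : Submodule k R) (F : Submodule k M) :
    (I * J) • F = I • J • F :=
  Submodule.smul_assoc I J F

/-! ### Finite length of modules over the Weyl algebra -/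

section FiniteLength

variable {k D : Type*} [Field k] [Ring D] [Algebra k D] {n : ℕ} {x d : Fin n → D}
  {Q : Type*} [AddCommGroup Q] [Module k Q] [Module D Q] [IsScalarTower k D Q]

/-- If no cyclic submodule grows like a polynomial of degree `n + 1`, then every finite-dimensional
subspace grows at most like a polynomial of degree `n`. -/
theorem exists_finrank_weylSpan_pow_smul_le (h : WeylRelations x d)
    (hgrowth : ∀ v : Q, ∃ t, Module.finrank k
      ↥(weylSpan k x d ^ ((n + 1) * t) • Submodule.span k {v}) < (t + 1) ^ (n + 1))
    {F : Submodule k Q} (hF : F.FG) :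
    ∃ K, ∀ r, Module.finrank k ↥(weylSpan k x d ^ r • F) ≤ K * (r + 1) ^ n := by
  classical
  obtain ⟨S, rfl⟩ := hF
  induction S using Finset.induction_on with
  | empty => exact ⟨0, fun r => by
      rw [Finset.coe_empty, Submodule.span_empty, Submodule.smul_bot, finrank_bot]
      exact Nat.zero_le _⟩
  | insert v S _ ih =>
    obtain ⟨K, hK⟩ := ih
    rcases growth_dichotomy (k := k) h v n with hv | ⟨K', hK'⟩
    · obtain ⟨t, ht⟩ := hgrowth v
      exact absurd (hv t) (not_le.2 ht)
    · refine ⟨K' + K, fun r => ?_⟩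
      rw [Finset.coe_insert, Submodule.span_insert, Submodule.smul_sup, add_mul]
      have := Module.Finite.iff_fg.2 (smul_fg ((weylSpan_fg (k := k) (x := x) (d := d)).pow r)
        (Submodule.fg_span_singleton v))
      have := Module.Finite.iff_fg.2 (smul_fg ((weylSpan_fg (k := k) (x := x) (d := d)).pow r)
        (Submodule.fg_span S.finite_toSet))
      exact (Submodule.finrank_add_le_finrank_add_finrank _ _).trans
        (Nat.add_le_add (hK' r) (hK r))

/-- A module generated by a finite-dimensional subspace whose growth along the Bernstein
filtration is at most polynomial of degree `n` has finite length: by Bernstein's inequality, each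
step of a chain of submodules contributes at least a fixed multiple of the polynomial growth of
degree `n`. -/
theorem isFiniteLength_of_finrank_le [CharZero k] (h : WeylRelations x d)
    {F : Submodule k Q} (hF : F.FG)
    (htop : ∀ y : Q, ∃ s, y ∈ weylSpan k x d ^ s • F) {K : ℕ}
    (hK : ∀ r, Module.finrank k ↥(weylSpan k x d ^ r • F) ≤ K * (r + 1) ^ n) :
    IsFiniteLength D Q := by
  have hmono : Monotone fun s => weylSpan k x d ^ s • F := fun a b hab =>
    Submodule.smul_mono_left (pow_le_pow_right' (Submodule.one_le.2 one_mem_weylSpan) hab)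
  have hlen : ∀ p : LTSeries (Submodule D Q), p.length ≤ K * (4 * n + 1) ^ n := by
    intro p
    have hlt : ∀ i < p.length, p.toFun (Fin.ofNat (p.length + 1) i) <
        p.toFun (Fin.ofNat (p.length + 1) (i + 1)) := by
      intro i hi
      refine p.strictMono ?_
      rw [Fin.lt_def, Fin.val_ofNat, Fin.val_ofNat, Nat.mod_eq_of_lt (by lia),
        Nat.mod_eq_of_lt (by lia)]
      exact Nat.lt_succ_self i
    -- The chain `p`, continued by its last term.
    let S : ℕ → Submodule D Q := fun i => p.toFun (Fin.ofNat (p.length + 1) (min i p.length))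
    have hS : Monotone S := by
      intro i j hij
      refine p.strictMono.monotone ?_
      rw [Fin.le_def, Fin.val_ofNat, Fin.val_ofNat, Nat.mod_eq_of_lt (by lia),
        Nat.mod_eq_of_lt (by lia)]
      exact min_le_min_right _ hij
    have hex : ∀ i, ∃ y, i < p.length → y ∈ S (i + 1) ∧ y ∉ S i := by
      intro i
      by_cases hi : i < p.length
      · obtain ⟨y, hy, hy'⟩ := Set.exists_of_ssubset (hlt i hi)
        refine ⟨y, fun _ => ⟨?_, ?_⟩⟩
        · simp only [S, min_eq_left (Nat.succ_le_of_lt hi)]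
          exact hy
        · simp only [S, min_eq_left hi.le]
          exact hy'
      · exact ⟨0, fun h => absurd h hi⟩
    choose v hv using hex
    choose s hs using htop
    obtain ⟨t, ht⟩ : ∃ t, ∀ i < p.length, s (v i) ≤ t :=
      ⟨(Finset.range p.length).sup fun i => s (v i), fun i hi =>
        Finset.le_sup (f := fun i => s (v i)) (Finset.mem_range.2 hi)⟩
    have hchain := mul_le_finrank_of_chain (k := k) h t
      (G := weylSpan k x d ^ (4 * n * t + t) • F) (smul_fg (weylSpan_fg.pow (4 * n * t + t)) hF)
      S v p.length hS (fun i hi => (hv i hi).1)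
      (fun i hi => (hv i hi).2) (fun i hi => by
        rw [pow_add, mul_smul_eq]
        refine Submodule.smul_mono le_rfl ?_
        rw [Submodule.span_singleton_le_iff_mem]
        exact hmono (ht i hi) (hs (v i)))
    have h2 : p.length * (t + 1) ^ n ≤ K * (4 * n + 1) ^ n * (t + 1) ^ n :=
      calc _ ≤ K * (4 * n * t + t + 1) ^ n := hchain.trans (hK _)
        _ ≤ K * ((4 * n + 1) * (t + 1)) ^ n :=
          Nat.mul_le_mul_left _ (Nat.pow_le_pow_left (by lia) n)
        _ = _ := by rw [mul_pow, mul_assoc]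
    exact Nat.le_of_mul_le_mul_right h2 (by positivity)
  rw [← Module.length_ne_top_iff]
  have hdim : Order.krullDim (Submodule D Q) ≤
      (((K * (4 * n + 1) ^ n : ℕ) : ℕ∞) : WithBot ℕ∞) :=
    iSup_le fun p => by exact_mod_cast hlen p
  rw [← Module.coe_length] at hdim
  exact ne_top_of_le_ne_top (ENat.natCast_ne_top _) (WithBot.coe_le_coe.1 hdim)

end FiniteLength

/-! ### Gelfand-Kirillov dimension bounds growth -/

section GKDim

variable {k R M : Type*} [Field k] [Ring R] [Algebra k R] [AddCommGroup M] [Module k M]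
  [Module R M] [IsScalarTower k R M]

/-- The powers of a subspace that contains `1` and generates the algebra exhaust the algebra, so
each finite-dimensional subspace lies in one of them. -/
theorem exists_le_pow_of_fg {C : Submodule k R} (h1 : 1 ∈ C)
    (hC : Algebra.adjoin k (C : Set R) = ⊤) {E : Submodule k R} (hE : E.FG) :
    ∃ b, E ≤ C ^ b := by
  have hmono : Monotone fun b => C ^ b := fun a b hab =>
    pow_le_pow_right' (Submodule.one_le.2 h1) hab
  have hmem : ∀ r : R, ∃ b, r ∈ C ^ b := by
    intro r
    have hr : r ∈ Algebra.adjoin k (C : Set R) := hC ▸ Algebra.mem_top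
    induction hr using Algebra.adjoin_induction with
    | mem c hc => exact ⟨1, by simpa using hc⟩
    | algebraMap c => exact ⟨0, by rw [pow_zero]; exact Submodule.algebraMap_mem c⟩
    | add a b _ _ ha hb =>
      obtain ⟨i, hi⟩ := ha
      obtain ⟨j, hj⟩ := hb
      exact ⟨max i j, add_mem (hmono (le_max_left i j) hi) (hmono (le_max_right i j) hj)⟩
    | mul a b _ _ ha hb =>
      obtain ⟨i, hi⟩ := ha
      obtain ⟨j, hj⟩ := hb
      exact ⟨i + j, by rw [pow_add]; exact Submodule.mul_mem_mul hi hj⟩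
  obtain ⟨S, rfl⟩ := hE
  choose f hf using hmem
  exact ⟨S.sup f, Submodule.span_le.2 fun r hr => hmono (Finset.le_sup hr) (hf r)⟩

theorem exists_le_pow_smul_of_fg {C : Submodule k R} {M₀ : Submodule k M} (h1 : 1 ∈ C)
    (hC : Algebra.adjoin k (C : Set R) = ⊤) (hM : Submodule.span R (M₀ : Set M) = ⊤)
    {F : Submodule k M} (hF : F.FG) : ∃ s, F ≤ C ^ s • M₀ := by
  have hmono : Monotone fun b => C ^ b • M₀ := fun a b hab =>
    Submodule.smul_mono_left (pow_le_pow_right' (Submodule.one_le.2 h1) hab)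
  have hmem : ∀ y : M, ∃ b, y ∈ C ^ b • M₀ := by
    intro y
    have hy : y ∈ Submodule.span R (M₀ : Set M) := hM ▸ Submodule.mem_top
    induction hy using Submodule.span_induction with
    | mem c hc => exact ⟨0, by rw [pow_zero, Submodule.one_smul]; exact hc⟩
    | zero => exact ⟨0, zero_mem _⟩
    | add a b _ _ ha hb =>
      obtain ⟨i, hi⟩ := ha
      obtain ⟨j, hj⟩ := hb
      exact ⟨max i j, add_mem (hmono (le_max_left i j) hi) (hmono (le_max_right i j) hj)⟩
    | smul r a _ ha =>
      obtain ⟨i, hi⟩ := ha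
      obtain ⟨j, hj⟩ := exists_le_pow_of_fg h1 hC (Submodule.fg_span_singleton r)
      refine ⟨j + i, ?_⟩
      rw [pow_add, mul_smul_eq]
      exact Submodule.smul_mem_smul (hj (Submodule.mem_span_singleton_self r)) hi
  obtain ⟨S, rfl⟩ := hF
  choose f hf using hmem
  exact ⟨S.sup f, Submodule.span_le.2 fun r hr => hmono (Finset.le_sup hr) (hf r)⟩

/-- If the Gelfand-Kirillov dimension is `n`, no finite-dimensional subspaces `E` and `F` can
produce growth of degree `n + 1`. -/
theorem HasGKDim.exists_finrank_pow_smul_lt {n : ℕ} (h : HasGKDim k R M ((n : ℝ) : EReal))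
    {E : Submodule k R} (hE : E.FG) {F : Submodule k M} (hF : F.FG) :
    ∃ t, Module.finrank k ↥(E ^ t • F) < t ^ (n + 1) := by
  obtain ⟨C, M₀, hCfg, h1, hC, hMfg, hM, hlim⟩ := h
  obtain ⟨b, hb⟩ := exists_le_pow_of_fg h1 hC hE
  obtain ⟨s, hs⟩ := exists_le_pow_smul_of_fg h1 hC hM hF
  -- The margin `1 / 2` absorbs the constants that come from `E ≤ C ^ b` and `F ≤ C ^ s • M₀`.
  have hlt : growthExponent C M₀ < (((n : ℝ) + 1 / 2 : ℝ) : EReal) := by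
    rw [hlim]
    exact_mod_cast lt_add_of_pos_right _ (by norm_num)
  have hev := Filter.eventually_lt_of_limsup_lt hlt
  have htend : Filter.Tendsto (fun t : ℕ => (b + 1) * t + s) Filter.atTop Filter.atTop :=
    Filter.tendsto_atTop_mono (fun t => by simp only [id]; nlinarith [Nat.zero_le (b * t)])
      Filter.tendsto_id
  have hpow : ∀ᶠ t : ℕ in Filter.atTop,
      ((b + 1 + s : ℕ) : ℝ) ^ ((n : ℝ) + 1 / 2) ≤ (t : ℝ) ^ (1 / 2 : ℝ) :=
    ((tendsto_rpow_atTop (by norm_num)).comp tendsto_natCast_atTop_atTop).eventually_ge_atTop _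
  obtain ⟨t, ⟨h2, h3⟩, h4⟩ :=
    ((htend.eventually hev).and hpow |>.and (Filter.eventually_ge_atTop 2)).exists
  refine ⟨t, ?_⟩
  set r := (b + 1) * t + s with hr
  have hr2 : 2 ≤ r := h4.trans (by nlinarith [Nat.zero_le (b * t)])
  have hsub : E ^ t • F ≤ C ^ r • M₀ := by
    have hle : (C ^ b) ^ t * C ^ s ≤ C ^ r := by
      rw [← pow_mul, ← pow_add]
      exact pow_le_pow_right' (Submodule.one_le.2 h1) (by rw [hr]; nlinarith)
    calc E ^ t • F ≤ (C ^ b) ^ t • C ^ s • M₀ := Submodule.smul_mono (pow_le_pow_left' hb t) hs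
      _ = ((C ^ b) ^ t * C ^ s) • M₀ := by rw [mul_smul_eq]
      _ ≤ _ := Submodule.smul_mono_left hle
  have : Module.Finite k ↥(C ^ r • M₀) := Module.Finite.iff_fg.2 (smul_fg (hCfg.pow _) hMfg)
  have hfin := Submodule.finrank_mono hsub
  rcases Nat.eq_zero_or_pos (Module.finrank k ↥(C ^ r • M₀)) with h0 | h0
  · rw [h0] at hfin
    exact hfin.trans_lt (by positivity)
  have h2' : Real.logb r (Module.finrank k ↥(C ^ r • M₀)) < (n : ℝ) + 1 / 2 := by
    exact_mod_cast h2
  rw [Real.logb_lt_iff_lt_rpow (by exact_mod_cast hr2) (by exact_mod_cast h0)] at h2'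
  have ht0 : (0 : ℝ) < t := by exact_mod_cast (by lia : 0 < t)
  have hrle : (r : ℝ) ≤ ((b + 1 + s : ℕ) : ℝ) * t := by
    exact_mod_cast (by rw [hr]; nlinarith : r ≤ (b + 1 + s) * t)
  have : (Module.finrank k ↥(E ^ t • F) : ℝ) < (t : ℝ) ^ (n + 1) :=
    calc (Module.finrank k ↥(E ^ t • F) : ℝ) ≤ Module.finrank k ↥(C ^ r • M₀) := by
          exact_mod_cast hfin
      _ < (r : ℝ) ^ ((n : ℝ) + 1 / 2) := h2'
      _ ≤ (((b + 1 + s : ℕ) : ℝ) * t) ^ ((n : ℝ) + 1 / 2) := by gcongr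
      _ = ((b + 1 + s : ℕ) : ℝ) ^ ((n : ℝ) + 1 / 2) * (t : ℝ) ^ ((n : ℝ) + 1 / 2) :=
          Real.mul_rpow (by positivity) ht0.le
      _ ≤ (t : ℝ) ^ (1 / 2 : ℝ) * (t : ℝ) ^ ((n : ℝ) + 1 / 2) := by gcongr
      _ = (t : ℝ) ^ (n + 1) := by
          rw [← Real.rpow_add ht0, ← Real.rpow_natCast]
          congr 1
          push_cast
          ring
  exact_mod_cast this

end GKDim

/-! ### Algebras that are finite up to commutators over a Weyl algebra -/

section Extension

variable {k R M : Type*} [Field k] [Ring R] [Algebra k R] [AddCommGroup M] [Module k M]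
  [Module R M] [IsScalarTower k R M] {n : ℕ}

theorem map_val_smul (D : Subalgebra k R) (S : Submodule k D) (F : Submodule k M) :
    S.map D.val.toLinearMap • F = S • F := by
  refine le_antisymm (Submodule.smul_le.2 ?_) (Submodule.smul_le.2 fun r hr m hm =>
    Submodule.smul_mem_smul (Submodule.mem_map_of_mem (f := D.val.toLinearMap) hr) hm)
  rintro _ ⟨r, hr, rfl⟩ m hm
  exact Submodule.smul_mem_smul (r := r) hr hm

/-- The subalgebra generated by the images of the generators of the Weyl algebra. -/
def weylAdjoin (k : Type*) {R : Type*} [Field k] [Ring R] [Algebra k R] {n : ℕ}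
    (x d : Fin n → R) : Subalgebra k R :=
  Algebra.adjoin k (Set.range x ∪ Set.range d)

variable {x d : Fin n → R}

theorem x_mem_weylAdjoin (i : Fin n) : x i ∈ weylAdjoin k x d :=
  Algebra.subset_adjoin (by simp)

theorem d_mem_weylAdjoin (i : Fin n) : d i ∈ weylAdjoin k x d :=
  Algebra.subset_adjoin (by simp)

theorem weylRelations_weylAdjoin (h : WeylRelations x d) :
    WeylRelations (fun i => (⟨x i, x_mem_weylAdjoin i⟩ : weylAdjoin k x d))
      (fun i => ⟨d i, d_mem_weylAdjoin i⟩) where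
  x_comm i j := Subtype.ext (h.x_comm i j)
  d_comm i j := Subtype.ext (h.d_comm i j)
  d_mul_x i j := Subtype.ext (by
    rw [Subalgebra.coe_mul, h.d_mul_x]
    split_ifs <;> simp)

theorem weylSpan_weylAdjoin_pow_smul (m : ℕ) (F : Submodule k M) :
    weylSpan k (fun i => (⟨x i, x_mem_weylAdjoin i⟩ : weylAdjoin k x d))
      (fun i => ⟨d i, d_mem_weylAdjoin i⟩) ^ m • F = weylSpan k x d ^ m • F := by
  rw [← map_val_smul, Submodule.map_pow]
  congr 2
  rw [weylSpan, weylSpan, Submodule.map_span, Set.image_union, Set.image_union, Set.image_singleton,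
    ← Set.range_comp, ← Set.range_comp]
  rfl

theorem adjoin_weylSpan_weylAdjoin :
    Algebra.adjoin k (weylSpan k (fun i => (⟨x i, x_mem_weylAdjoin i⟩ : weylAdjoin k x d))
      (fun i => ⟨d i, d_mem_weylAdjoin i⟩) : Set (weylAdjoin k x d)) = ⊤ := by
  refine top_le_iff.1 ((Algebra.adjoin_adjoin_coe_preimage (R := k)
    (s := Set.range x ∪ Set.range d)).ge.trans (Algebra.adjoin_mono ?_))
  rintro ⟨_, _⟩ (⟨i, rfl⟩ | ⟨i, rfl⟩)
  · exact x_mem_weylSpan (x := fun i => (⟨x i, x_mem_weylAdjoin i⟩ : weylAdjoin k x d)) i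
  · exact d_mem_weylSpan (d := fun i => (⟨d i, d_mem_weylAdjoin i⟩ : weylAdjoin k x d)) i

/-- If `W` can be moved across the generators of the Weyl algebra, then it can be moved across all
its elements. -/
theorem mul_mem_weylAdjoin_mul {W : Submodule k R}
    (hx : ∀ w ∈ W, ∀ i, w * x i ∈ (weylAdjoin k x d).toSubmodule * W)
    (hd : ∀ w ∈ W, ∀ i, w * d i ∈ (weylAdjoin k x d).toSubmodule * W) {r : R}
    (hr : r ∈ weylAdjoin k x d) : ∀ w ∈ W, w * r ∈ (weylAdjoin k x d).toSubmodule * W := by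
  induction hr using Algebra.adjoin_induction with
  | mem r hr =>
    rintro w hw
    rcases hr with ⟨i, rfl⟩ | ⟨i, rfl⟩
    exacts [hx w hw i, hd w hw i]
  | algebraMap c =>
    intro w hw
    rw [← Algebra.commutes]
    exact Submodule.mul_mem_mul (Subalgebra.algebraMap_mem _ c) hw
  | add a b _ _ ha hb =>
    intro w hw
    rw [mul_add]
    exact add_mem (ha w hw) (hb w hw)
  | mul a b _ _ ha hb =>
    intro w hw
    rw [← mul_assoc]
    refine Submodule.mul_induction_on (ha w hw) (fun r hr u hu => ?_) fun y z hy hz => ?_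
    · rw [mul_assoc, ← (weylAdjoin k x d).isIdempotentElem_toSubmodule.eq, mul_assoc]
      exact Submodule.mul_mem_mul hr (hb u hu)
    · rw [add_mul]
      exact add_mem hy hz

/-- Let the algebra `R` be generated by elements satisfying the Weyl relations and by a
finite-dimensional subspace `W` that can be moved across these elements. An `R`-module of
Gelfand-Kirillov dimension `n` is finitely generated over the subalgebra `D` generated by the Weyl
generators: otherwise the chain of the submodules generated over `D` by `W ^ j • M₀` would be
strictly increasing, and Bernstein's inequality for each of its steps would produce growth of degree
`n + 1`. -/
theorem exists_fg_span_weylAdjoin_eq_top [CharZero k] (h : WeylRelations x d)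
    {W : Submodule k R} (hW : W.FG) (h1 : 1 ∈ W)
    (hx : ∀ w ∈ W, ∀ i, w * x i ∈ (weylAdjoin k x d).toSubmodule * W)
    (hd : ∀ w ∈ W, ∀ i, w * d i ∈ (weylAdjoin k x d).toSubmodule * W)
    (hgen : Algebra.adjoin k (weylAdjoin k x d ∪ W : Set R) = ⊤)
    (hGK : HasGKDim k R M ((n : ℝ) : EReal)) :
    ∃ F : Submodule k M, F.FG ∧ Submodule.span (weylAdjoin k x d) (F : Set M) = ⊤ := by
  obtain ⟨M₀, hM₀, hspan⟩ : ∃ M₀ : Submodule k M, M₀.FG ∧ Submodule.span R (M₀ : Set M) = ⊤ := by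
    obtain ⟨C, M₀, -, -, -, h, h', -⟩ := hGK
    exact ⟨M₀, h, h'⟩
  let D := weylAdjoin k x d
  let S : ℕ → Submodule D M := fun j => Submodule.span D (W ^ j • M₀ : Submodule k M)
  have hWmono : Monotone fun j => W ^ j • M₀ := fun a b hab =>
    Submodule.smul_mono_left (pow_le_pow_right' (Submodule.one_le.2 h1) hab)
  have hSmono : Monotone S := fun a b hab => Submodule.span_mono (hWmono hab)
  obtain ⟨j, hj⟩ : ∃ j, ∀ y ∈ W ^ (j + 1) • M₀, y ∈ S j := by
    by_contra! hne
    choose v hv hv' using hne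
    -- The vectors `v 0, …, v (t - 1)` lie in `E ^ t • M₀`, so the filtration steps that they
    -- generate lie in `E ^ (4 * n * t + t) • M₀`.
    let E := weylSpan k x d ⊔ W
    have hE1 : 1 ≤ E := Submodule.one_le.2 (Submodule.mem_sup_right h1)
    have hE : E.FG := weylSpan_fg.sup hW
    obtain ⟨t, ht⟩ := hGK.exists_finrank_pow_smul_lt (hE.pow (4 * n + 1)) hM₀
    have hchain := mul_le_finrank_of_chain (k := k) (weylRelations_weylAdjoin (k := k) h) t
      (G := (E ^ (4 * n + 1)) ^ t • M₀) (smul_fg ((hE.pow _).pow t) hM₀) S v t hSmono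
      (fun i _ => Submodule.subset_span (hv i)) (fun i _ => hv' i) (fun i hi => by
        rw [weylSpan_weylAdjoin_pow_smul, ← pow_mul, add_mul, one_mul, pow_add, mul_smul_eq]
        refine Submodule.smul_mono (pow_le_pow_left' le_sup_left _) ?_
        rw [Submodule.span_singleton_le_iff_mem]
        exact Submodule.smul_mono_left ((pow_le_pow_left' le_sup_right _).trans
          (pow_le_pow_right' hE1 hi)) (hv i))
    refine absurd (hchain.trans_lt ht) (not_lt.2 ?_)
    rw [pow_succ']
    gcongr
    exact Nat.le_succ t
  refine ⟨W ^ j • M₀, smul_fg (hW.pow j) hM₀, ?_⟩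
  -- The submodule `S j` is stable under `W` and `D`, hence under `R`, and contains `M₀`.
  have hWS : ∀ y ∈ S j, ∀ w ∈ W, w • y ∈ S j := by
    intro y hy
    induction hy using Submodule.span_induction with
    | mem y hy =>
      intro w hw
      refine hj _ ?_
      rw [pow_succ', mul_smul_eq]
      exact Submodule.smul_mem_smul hw hy
    | zero => intro w _; rw [smul_zero]; exact zero_mem _
    | add y z _ _ hy hz => intro w hw; rw [smul_add]; exact add_mem (hy w hw) (hz w hw)
    | smul r y _ hy =>
      intro w hw
      have hwr := mul_mem_weylAdjoin_mul hx hd r.2 w hw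
      change w • (r : R) • y ∈ S j
      rw [← mul_smul]
      refine Submodule.mul_induction_on hwr (fun a ha b hb => ?_) fun a b ha hb => ?_
      · rw [mul_smul]
        exact (S j).smul_mem (⟨a, ha⟩ : D) (hy b hb)
      · rw [add_smul]
        exact add_mem ha hb
  have hRS : ∀ r : R, ∀ y ∈ S j, r • y ∈ S j := by
    intro r
    have hr : r ∈ Algebra.adjoin k (weylAdjoin k x d ∪ W : Set R) := hgen ▸ Algebra.mem_top
    induction hr using Algebra.adjoin_induction with
    | mem r hr =>
      intro y hy
      rcases hr with hr | hr
      exacts [(S j).smul_mem (⟨r, hr⟩ : D) hy, hWS y hy r hr]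
    | algebraMap c => exact fun y hy => (S j).smul_mem (algebraMap k D c) hy
    | add a b _ _ ha hb =>
      intro y hy
      rw [add_smul]
      exact add_mem (ha y hy) (hb y hy)
    | mul a b _ _ ha hb =>
      intro y hy
      rw [mul_smul]
      exact ha _ (hb y hy)
  rw [eq_top_iff]
  intro y _
  have hy : y ∈ Submodule.span R (M₀ : Set M) := hspan ▸ Submodule.mem_top
  change y ∈ S j
  induction hy using Submodule.span_induction with
  | mem y hy =>
    refine Submodule.subset_span (hWmono (Nat.zero_le j) ?_)
    simp only [pow_zero]
    rw [Submodule.one_smul]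
    exact hy
  | zero => exact zero_mem _
  | add y z _ _ hy hz => exact add_mem (hy trivial) (hz trivial)
  | smul r y _ hy => exact hRS r y (hy trivial)

theorem isFiniteLength_of_hasGKDim [CharZero k] (h : WeylRelations x d)
    {W : Submodule k R} (hW : W.FG) (h1 : 1 ∈ W)
    (hx : ∀ w ∈ W, ∀ i, w * x i ∈ (weylAdjoin k x d).toSubmodule * W)
    (hd : ∀ w ∈ W, ∀ i, w * d i ∈ (weylAdjoin k x d).toSubmodule * W)
    (hgen : Algebra.adjoin k (weylAdjoin k x d ∪ W : Set R) = ⊤)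
    (hGK : HasGKDim k R M ((n : ℝ) : EReal)) : IsFiniteLength R M := by
  obtain ⟨F, hF, htop⟩ := exists_fg_span_weylAdjoin_eq_top h hW h1 hx hd hgen hGK
  have h' := weylRelations_weylAdjoin (k := k) h
  obtain ⟨K, hK⟩ := exists_finrank_weylSpan_pow_smul_le (k := k) (Q := M) h' (fun v => by
    obtain ⟨t, ht⟩ := hGK.exists_finrank_pow_smul_lt
      ((weylSpan_fg (k := k) (x := x) (d := d)).pow (n + 1)) (Submodule.fg_span_singleton v)
    refine ⟨t, ?_⟩
    rw [weylSpan_weylAdjoin_pow_smul, pow_mul]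
    exact ht.trans_le (Nat.pow_le_pow_left (Nat.le_succ t) _)) hF
  have hlen : IsFiniteLength (weylAdjoin k x d) M :=
    isFiniteLength_of_finrank_le h' hF (fun y => by
      obtain ⟨s, hs⟩ := exists_le_pow_smul_of_fg
        (C := weylSpan k (fun i => (⟨x i, x_mem_weylAdjoin i⟩ : weylAdjoin k x d))
          (fun i => ⟨d i, d_mem_weylAdjoin i⟩))
        one_mem_weylSpan adjoin_weylSpan_weylAdjoin htop (Submodule.fg_span_singleton y)
      exact ⟨s, hs (Submodule.mem_span_singleton_self y)⟩) hK
  rw [isFiniteLength_iff_isNoetherian_isArtinian] at hlen ⊢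
  obtain ⟨_, _⟩ := hlen
  exact ⟨isNoetherian_of_tower (weylAdjoin k x d) inferInstance,
    isArtinian_of_tower (weylAdjoin k x d) inferInstance⟩

end Extension

/-! ### The smash product of polynomials with polynomial vector fields -/

section AffineSmashProduct

open MvPolynomial DerSmashProduct

section General

attribute [local instance 100] LieRing.ofAssociativeRing

variable (k A : Type*) [CommRing k] [CommRing A] [Algebra k A]

/-- The inclusion `f ↦ f # 1` of `A` in the smash product. -/
noncomputable def functionIncl : A →ₐ[k] DerSmashProduct k A :=
  AlgHom.ofLinearMap ((TensorProduct.mk k A _).flip 1 : A →ₗ[k] DerSmashProduct k A) rfl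
    fun f g => by
      change (f * g) ⊗ₜ[k] (1 : UniversalEnvelopingAlgebra k (Derivation k A A)) =
        mulHom k A (f ⊗ₜ[k] 1) (g ⊗ₜ[k] 1)
      rw [mulHom_tmul, map_one, mul_one, leftMul_tmul]

/-- The inclusion `η ↦ 1 # η` of `Der A` in the smash product. -/
noncomputable def derivationIncl : Derivation k A A →ₗ[k] DerSmashProduct k A :=
  (TensorProduct.mk k A _ 1 : _ →ₗ[k] DerSmashProduct k A).comp
    (UniversalEnvelopingAlgebra.ι k : Derivation k A A →ₗ⁅k⁆ _).toLinearMap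

variable {k A}

theorem functionIncl_mul_tmul (f g : A) (u : UniversalEnvelopingAlgebra k (Derivation k A A)) :
    functionIncl k A f * tmul k g u = tmul k (f * g) u := by
  change mulHom k A (f ⊗ₜ[k] 1) (g ⊗ₜ[k] u) = (f * g) ⊗ₜ[k] u
  rw [mulHom_tmul, map_one, mul_one, leftMul_tmul]

theorem derivationIncl_mul_tmul (η : Derivation k A A) (g : A)
    (u : UniversalEnvelopingAlgebra k (Derivation k A A)) :
    derivationIncl k A η * tmul k g u =
      tmul k (η g) u + tmul k g (UniversalEnvelopingAlgebra.ι k η * u) := by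
  have := tmul_mul_tmul (k := k) 1 g η u
  rwa [one_mul, one_mul] at this

theorem derivationIncl_mul_tmul_one (η : Derivation k A A)
    (u : UniversalEnvelopingAlgebra k (Derivation k A A)) :
    derivationIncl k A η * tmul k 1 u = tmul k 1 (UniversalEnvelopingAlgebra.ι k η * u) := by
  have h0 : tmul k (0 : A) u = 0 := TensorProduct.zero_tmul _ _
  rw [derivationIncl_mul_tmul, Derivation.map_one_eq_zero, h0, zero_add]

theorem derivationIncl_mul_functionIncl (η : Derivation k A A) (g : A) :
    derivationIncl k A η * functionIncl k A g =
      functionIncl k A g * derivationIncl k A η + functionIncl k A (η g) := by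
  have h1 : derivationIncl k A η * functionIncl k A g =
      tmul k (η g) 1 + tmul k g (UniversalEnvelopingAlgebra.ι k η * 1) :=
    derivationIncl_mul_tmul η g 1
  have h2 : functionIncl k A g * derivationIncl k A η =
      tmul k (g * 1) (UniversalEnvelopingAlgebra.ι k η) := functionIncl_mul_tmul g 1 _
  rw [h1, h2, mul_one, mul_one, add_comm]
  rfl

theorem derivationIncl_lie (η μ : Derivation k A A) :
    derivationIncl k A ⁅η, μ⁆ = derivationIncl k A η * derivationIncl k A μ -
      derivationIncl k A μ * derivationIncl k A η := by
  have h : ∀ η μ : Derivation k A A, derivationIncl k A η * derivationIncl k A μ =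
      tmul k 1 (UniversalEnvelopingAlgebra.ι k η * UniversalEnvelopingAlgebra.ι k μ) :=
    fun η μ => derivationIncl_mul_tmul_one η _
  rw [h, h]
  change (1 : A) ⊗ₜ[k] (UniversalEnvelopingAlgebra.ι k ⁅η, μ⁆) = (1 : A) ⊗ₜ[k] _ - (1 : A) ⊗ₜ[k] _
  rw [LieHom.map_lie, LieRing.of_associative_ring_bracket, TensorProduct.tmul_sub]
  rfl

end General

variable {k : Type*} [Field k] {n : ℕ}

/-- The coordinate functions, in the smash product. -/
noncomputable def smashX (k : Type*) [Field k] (n : ℕ) (i : Fin n) : AffineAV k n :=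
  functionIncl k _ (X i)

/-- The partial derivatives, in the smash product. -/
noncomputable def smashD (k : Type*) [Field k] (n : ℕ) (i : Fin n) : AffineAV k n :=
  derivationIncl k _ (pderiv i)

theorem lie_pderiv_pderiv (i j : Fin n) :
    ⁅pderiv (R := k) i, pderiv (R := k) j⁆ = 0 := by
  classical
  refine derivation_ext fun l => ?_
  rw [Derivation.commutator_apply, pderiv_X, pderiv_X]
  simp only [Pi.single_apply]
  split_ifs <;> simp

theorem weylRelations_smash (k : Type*) [Field k] (n : ℕ) :
    WeylRelations (smashX k n) (smashD k n) where
  x_comm i j := by rw [smashX, smashX, ← map_mul, ← map_mul, mul_comm]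
  d_comm i j := by
    rw [← sub_eq_zero, smashD, smashD, ← derivationIncl_lie, lie_pderiv_pderiv, map_zero]
  d_mul_x i j := by
    classical
    rw [smashX, smashD, derivationIncl_mul_functionIncl, pderiv_X]
    by_cases h : i = j
    · subst h; simp
    · simp [h, Ne.symm h]

/-- The vector fields with coefficients of degree at most `r`. -/
def boundedVectorFields (k : Type*) [Field k] (n r : ℕ) :
    Submodule k (Derivation k (MvPolynomial (Fin n) k) (MvPolynomial (Fin n) k)) where
  carrier := {η | ∀ j, η (X j) ∈ restrictTotalDegree (Fin n) k r}
  add_mem' ha hb j := add_mem (ha j) (hb j)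
  zero_mem' _ := zero_mem _
  smul_mem' c _ ha j := Submodule.smul_mem _ c (ha j)

theorem mem_boundedVectorFields {r : ℕ}
    {η : Derivation k (MvPolynomial (Fin n) k) (MvPolynomial (Fin n) k)} :
    η ∈ boundedVectorFields k n r ↔ ∀ j, (η (X j)).totalDegree ≤ r :=
  forall_congr' fun _ => mem_restrictTotalDegree _ _ _

theorem boundedVectorFields_fg (r : ℕ) : (boundedVectorFields k n r).FG := by
  have h : boundedVectorFields k n r ≤
      (Submodule.pi Set.univ fun _ : Fin n => restrictTotalDegree (Fin n) k r).map
        (mkDerivationEquiv k : (Fin n → MvPolynomial (Fin n) k) ≃ₗ[k] _).toLinearMap := by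
    intro η hη
    exact ⟨fun j => η (X j), fun j _ => hη j, derivation_ext fun j => mkDerivation_X _ _ _⟩
  have hfin : Module.Finite k (restrictTotalDegree (Fin n) k r) := inferInstance
  have := Module.Finite.iff_fg.2 ((Submodule.fg_pi fun _ : Fin n =>
    Module.Finite.iff_fg.1 hfin).map
      (mkDerivationEquiv k : (Fin n → MvPolynomial (Fin n) k) ≃ₗ[k] _).toLinearMap)
  exact Module.Finite.iff_fg.1 (Submodule.finiteDimensional_of_le h)

theorem boundedVectorFields_mono {r s : ℕ} (h : r ≤ s) :
    boundedVectorFields k n r ≤ boundedVectorFields k n s := fun _ hη =>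
  mem_boundedVectorFields.2 fun j => (mem_boundedVectorFields.1 hη j).trans h

theorem exists_mem_boundedVectorFields
    (η : Derivation k (MvPolynomial (Fin n) k) (MvPolynomial (Fin n) k)) :
    ∃ r, η ∈ boundedVectorFields k n r :=
  ⟨Finset.univ.sup fun j => (η (X j)).totalDegree, mem_boundedVectorFields.2 fun j =>
    Finset.le_sup (f := fun j => (η (X j)).totalDegree) (Finset.mem_univ j)⟩

theorem totalDegree_pderiv_le {σ : Type*} (i : σ) (p : MvPolynomial σ k) :
    (pderiv i p).totalDegree ≤ p.totalDegree := by
  refine Finset.sup_le fun s hs => ?_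
  rw [mem_support_iff, coeff_pderiv] at hs
  have := le_totalDegree (mem_support_iff.2 (left_ne_zero_of_mul hs))
  refine le_trans ?_ this
  change s.degree ≤ (s + Finsupp.single i 1).degree
  simp

theorem lie_pderiv_mem_boundedVectorFields {r : ℕ}
    {η : Derivation k (MvPolynomial (Fin n) k) (MvPolynomial (Fin n) k)}
    (hη : η ∈ boundedVectorFields k n r) (i : Fin n) :
    ⁅pderiv (R := k) i, η⁆ ∈ boundedVectorFields k n r := by
  classical
  refine mem_boundedVectorFields.2 fun j => ?_
  have : η (pderiv i (X j)) = 0 := by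
    rw [pderiv_X, Pi.single_apply]
    split_ifs <;> simp
  rw [Derivation.commutator_apply, this, sub_zero]
  exact (totalDegree_pderiv_le i _).trans (mem_boundedVectorFields.1 hη j)

/-- The span in the smash product of `1` and the vector fields with coefficients of degree at most
`r`. -/
noncomputable def boundedSpan (k : Type*) [Field k] (n r : ℕ) : Submodule k (AffineAV k n) :=
  Submodule.span k {1} ⊔ (boundedVectorFields k n r).map (derivationIncl k _)

theorem boundedSpan_fg (r : ℕ) : (boundedSpan k n r).FG :=
  (Submodule.fg_span_singleton _).sup ((boundedVectorFields_fg r).map _)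

theorem one_mem_boundedSpan (r : ℕ) : 1 ∈ boundedSpan k n r :=
  Submodule.mem_sup_left (Submodule.mem_span_singleton_self _)

theorem derivationIncl_mem_boundedSpan {r : ℕ}
    {η : Derivation k (MvPolynomial (Fin n) k) (MvPolynomial (Fin n) k)}
    (hη : η ∈ boundedVectorFields k n r) : derivationIncl k _ η ∈ boundedSpan k n r :=
  Submodule.mem_sup_right (Submodule.mem_map_of_mem hη)

theorem functionIncl_mem_weylAdjoin (f : MvPolynomial (Fin n) k) :
    functionIncl k _ f ∈ weylAdjoin k (smashX k n) (smashD k n) := by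
  induction f using MvPolynomial.induction_on with
  | C c => exact (AlgHom.commutes (functionIncl k (MvPolynomial (Fin n) k)) c).symm ▸
      Subalgebra.algebraMap_mem _ c
  | add p q hp hq => rw [map_add]; exact add_mem hp hq
  | mul_X p i hp => rw [map_mul]; exact mul_mem hp (x_mem_weylAdjoin i)

theorem boundedSpan_mul_mem {r : ℕ} {y : AffineAV k n}
    (hy : y ∈ weylAdjoin k (smashX k n) (smashD k n))
    (H : ∀ η ∈ boundedVectorFields k n r, derivationIncl k _ η * y ∈
      (weylAdjoin k (smashX k n) (smashD k n)).toSubmodule * boundedSpan k n r)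
    {w : AffineAV k n} (hw : w ∈ boundedSpan k n r) :
    w * y ∈ (weylAdjoin k (smashX k n) (smashD k n)).toSubmodule * boundedSpan k n r := by
  obtain ⟨a, ha, _, ⟨η, hη, rfl⟩, rfl⟩ := Submodule.mem_sup.1 hw
  obtain ⟨c, rfl⟩ := Submodule.mem_span_singleton.1 ha
  rw [add_mul]
  refine add_mem ?_ (H η hη)
  rw [smul_mul_assoc, one_mul]
  refine Submodule.smul_mem _ c ?_
  simpa using Submodule.mul_mem_mul hy (one_mem_boundedSpan (k := k) r)

theorem boundedSpan_mul_smashX_mem {r : ℕ} {w : AffineAV k n} (hw : w ∈ boundedSpan k n r)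
    (i : Fin n) : w * smashX k n i ∈
      (weylAdjoin k (smashX k n) (smashD k n)).toSubmodule * boundedSpan k n r := by
  refine boundedSpan_mul_mem (x_mem_weylAdjoin i) (fun η hη => ?_) hw
  rw [smashX, derivationIncl_mul_functionIncl]
  refine add_mem (Submodule.mul_mem_mul (functionIncl_mem_weylAdjoin _)
    (derivationIncl_mem_boundedSpan hη)) ?_
  simpa using Submodule.mul_mem_mul (functionIncl_mem_weylAdjoin (η (X i)))
    (one_mem_boundedSpan (k := k) r)

theorem boundedSpan_mul_smashD_mem {r : ℕ} {w : AffineAV k n} (hw : w ∈ boundedSpan k n r)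
    (i : Fin n) : w * smashD k n i ∈
      (weylAdjoin k (smashX k n) (smashD k n)).toSubmodule * boundedSpan k n r := by
  refine boundedSpan_mul_mem (d_mem_weylAdjoin i) (fun η hη => ?_) hw
  have h : derivationIncl k _ η * smashD k n i = smashD k n i * derivationIncl k _ η -
      derivationIncl k _ ⁅pderiv (R := k) i, η⁆ := by
    rw [derivationIncl_lie, smashD, sub_sub_cancel]
  rw [h]
  refine sub_mem (Submodule.mul_mem_mul (d_mem_weylAdjoin i)
    (derivationIncl_mem_boundedSpan hη)) ?_
  simpa using Submodule.mul_mem_mul ((Subalgebra.mem_toSubmodule _).2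
    (one_mem (weylAdjoin k (smashX k n) (smashD k n))))
    (derivationIncl_mem_boundedSpan (lie_pderiv_mem_boundedVectorFields hη i))

/-- A finitely generated smash product is generated by `A`, the partial derivatives and the vector
fields of bounded degree. -/
theorem exists_adjoin_boundedSpan_eq_top {C : Submodule k (AffineAV k n)} (hC : C.FG)
    (hgen : Algebra.adjoin k (C : Set (AffineAV k n)) = ⊤) :
    ∃ r, Algebra.adjoin k (weylAdjoin k (smashX k n) (smashD k n) ∪ boundedSpan k n r :
      Set (AffineAV k n)) = ⊤ := by
  let T : ℕ → Subalgebra k (AffineAV k n) := fun r =>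
    Algebra.adjoin k (weylAdjoin k (smashX k n) (smashD k n) ∪ boundedSpan k n r)
  have hT : Monotone T := fun r s hrs => Algebra.adjoin_mono (Set.union_subset_union_right _
    (SetLike.coe_subset_coe.2
      (sup_le_sup_left (Submodule.map_mono (boundedVectorFields_mono hrs)) _)))
  have hU : ∀ u : UniversalEnvelopingAlgebra k
      (Derivation k (MvPolynomial (Fin n) k) (MvPolynomial (Fin n) k)),
      ∀ v, (∃ r, tmul k 1 v ∈ T r) → ∃ r, tmul k 1 (u * v) ∈ T r := by
    intro u
    obtain ⟨t, rfl⟩ : ∃ t, UniversalEnvelopingAlgebra.mkAlgHom k _ t = u :=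
      RingCon.mkₐ_surjective _ u
    induction t using TensorAlgebra.induction with
    | algebraMap c =>
      rintro v ⟨r, hr⟩
      refine ⟨r, ?_⟩
      have : tmul k (1 : MvPolynomial (Fin n) k) (UniversalEnvelopingAlgebra.mkAlgHom k _
          (algebraMap k _ c) * v) = c • tmul k 1 v := by
        rw [AlgHom.commutes, ← Algebra.smul_def]
        exact TensorProduct.tmul_smul _ _ _
      rw [this]
      exact (T r).smul_mem hr c
    | ι η =>
      rintro v ⟨r, hr⟩
      obtain ⟨s, hs⟩ := exists_mem_boundedVectorFields η
      refine ⟨max r s, ?_⟩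
      change tmul k 1 (UniversalEnvelopingAlgebra.ι k η * v) ∈ T (max r s)
      rw [← derivationIncl_mul_tmul_one]
      exact mul_mem (hT (le_max_right r s)
        (Algebra.subset_adjoin (Or.inr (derivationIncl_mem_boundedSpan hs))))
        (hT (le_max_left r s) hr)
    | mul a b ha hb =>
      intro v hv
      rw [map_mul, mul_assoc]
      exact ha _ (hb v hv)
    | add a b ha hb =>
      intro v hv
      obtain ⟨r, hr⟩ := ha v hv
      obtain ⟨s, hs⟩ := hb v hv
      refine ⟨max r s, ?_⟩
      rw [map_add, add_mul]
      have := add_mem (hT (le_max_left r s) hr) (hT (le_max_right r s) hs)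
      rw [tmul, tmul] at this
      rw [tmul, TensorProduct.tmul_add]
      exact this
  have hmem : ∀ y : AffineAV k n, ∃ r, y ∈ T r := by
    intro y
    change MvPolynomial (Fin n) k ⊗[k] UniversalEnvelopingAlgebra k
      (Derivation k (MvPolynomial (Fin n) k) (MvPolynomial (Fin n) k)) at y
    induction y with
    | zero => exact ⟨0, zero_mem (T 0)⟩
    | add a b ha hb =>
      obtain ⟨r, hr⟩ := ha
      obtain ⟨s, hs⟩ := hb
      exact ⟨max r s, add_mem (hT (le_max_left r s) hr) (hT (le_max_right r s) hs)⟩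
    | tmul f u =>
      obtain ⟨r, hr⟩ := hU u 1 ⟨0, one_mem (T 0)⟩
      refine ⟨r, ?_⟩
      have h := functionIncl_mul_tmul (k := k) f 1 u
      rw [mul_one] at h hr
      change tmul k f u ∈ T r
      rw [← h]
      exact mul_mem (Algebra.subset_adjoin (Or.inl (functionIncl_mem_weylAdjoin f))) hr
  obtain ⟨S, rfl⟩ := hC
  choose f hf using hmem
  refine ⟨S.sup f, top_le_iff.1 (hgen ▸ Algebra.adjoin_le ?_)⟩
  have : Submodule.span k (S : Set (AffineAV k n)) ≤ Subalgebra.toSubmodule (T (S.sup f)) :=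
    Submodule.span_le.2 fun y hy => hT (Finset.le_sup hy) (hf y)
  exact this

end AffineSmashProduct

theorem mainTheorem2 (k : Type*) [Field k] [IsAlgClosed k] [CharZero k] [Uncountable k]
    (n : ℕ) (M : Type*) [AddCommGroup M] [Module k M] [Module (AffineAV k n) M]
    [IsScalarTower k (AffineAV k n) M] (hM : IsHolonomicAV k n M) :
    IsFiniteLength (AffineAV k n) M := by
  obtain ⟨-, hM | hM⟩ := hM
  · exact IsFiniteLength.of_subsingleton
  · obtain ⟨r, hr⟩ : ∃ r, Algebra.adjoin k (weylAdjoin k (smashX k n) (smashD k n) ∪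
        boundedSpan k n r : Set (AffineAV k n)) = ⊤ := by
      obtain ⟨C, -, hC, -, hgen, -⟩ := hM
      exact exists_adjoin_boundedSpan_eq_top hC hgen
    exact isFiniteLength_of_hasGKDim (weylRelations_smash k n) (boundedSpan_fg r)
      (one_mem_boundedSpan r) (fun w hw i => boundedSpan_mul_smashX_mem hw i)
      (fun w hw i => boundedSpan_mul_smashD_mem hw i) hr hM
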